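/- Let $K\subset[0,1]$ be the middle-third Cantor set, let $\kappa=\log 2/\log 3$, let $\|x\|$ denote the distance from the real number $x$ to the nearest integer, and let $\dim_{\mathrm H}$ denote Hausdorff dimension. Let $(a_n)_{n\ge 1}$ be a sequence of positive integers such that \[ \lim_{n\to\infty}\frac{\log(a_{n+1}/a_n)}{\log n}=\infty . \] Then, for Lebesgue almost every real number $\alpha$, the following holds for every real number $\nu\ge 1$. Let \[ A_{\alpha,\nu}=\Bigl\{\xi\in\mathbb{R} \;:\; \|a_n\alpha-\xi\|<\frac{1}{n^{\nu}}\ \text{ for infinitely many } n\ge 1\Bigr\}. \] Then \[ \dim_{\mathrm H} A_{\alpha,\nu}=\frac1\nu . \] Moreover, if $\frac1\nu+\kappa-1\ge 0$, then $A_{\alpha,\nu}\cap K$ is nonempty and \[ \dim_{\mathrm H}\bigl(A_{\alpha,\nu}\cap K\bigr)=\frac1\nu+\kappa-1 ; \] if $\frac1\nu+\kappa-1<0$, then $A_{\alpha,\nu}\cap K=\emptyset$. -/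

import Mathlib

open Filter MeasureTheory

noncomputable section

/-- The distance `‖x‖` from a real number `x` to the nearest integer. -/
def distNearestInt (x : ℝ) : ℝ := |x - (round x : ℝ)|

/-- The real numbers `ξ` such that `‖a_n α - ξ‖ < 1 / n ^ ν` for infinitely many `n ≥ 1`. -/
def approxSet (a : ℕ → ℕ) (α ν : ℝ) : Set ℝ :=
  {ξ : ℝ | {n : ℕ | 1 ≤ n ∧ distNearestInt ((a n : ℝ) * α - ξ) < 1 / (n : ℝ) ^ ν}.Infinite}

/-- The number `κ = log 2 / log 3`, the dimension of the middle-third Cantor set. -/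
def cantorDim : ℝ := Real.log 2 / Real.log 3

end

/-! The sequence grows faster than any power, in the sense that eventually `n ^ C * a n ≤ a m` for
all `m > n`. At scale `n ^ (-ν)` the events "`a n α` modulo `1` lies in a given union of triadic
intervals" are therefore almost pairwise independent, with relative error `3 ^ J * a n / a m`
(`measureReal_hitSet_inter_le`). Everything probabilistic is a first or second moment estimate built
on this.

Lower bounds. Let `D` be a set of `q` digits; `{0, 1, 2}` gives the unit interval and `{0, 2}` the
Cantor set. The points `a n α` with `2 ^ i ≤ n < 2 ^ (i + 1)`, discretised at scale about `2 ^ (-ν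
i)` and normalised, define a random weight on the level `J` intervals of the digit set whose mean is
the uniform weight. In the discrete Riesz energy with parameter `t = 3 ^ s`, the mean squared
deviation is at most about `(3 t / q) ^ J / 2 ^ i`, up to a summable error. This is summable exactly
when `s < 1 / ν + log_3 q - 1`, so almost surely the deviations tend to `0`
(`ae_tendsto_levelEnergy_blockDensity`). For such `α` one multiplies block densities along a sparse
sequence of blocks. Each factor perturbs the energy and the mass as little as desired, so the
energies stay bounded while the supports decrease to a subset of `approxSet a α ν ∩ digitSet D`. By
Cauchy–Schwarz, bounded energy forces positive `s`-dimensional Hausdorff measure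
(`hausdorffMeasure_iInter_weightSupport_ne_zero`).

Upper bounds. The approximating balls cover, which gives `1 / ν` for every `α`. For the Cantor set
only those `n` matter for which `a n α` is near it, an event of probability at most a multiple of `n
^ (-ν (1 - κ))`; the expected covering sum decides the dimension, and with exponent `0` it shows
that the set is empty beyond the critical `ν`.

At the critical exponent the dimension is `0` and says nothing about nonemptiness. There the hitting
probabilities are of order `1 / n`, and a quasi-independent Borel–Cantelli lemma yields nested
Cantor intervals hit by infinitely many `a n α`.

All statements are monotone in `ν`, so countably many rational parameters suffice for one null set.
-/

/-! ### Words in a digit set, coded as integers -/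

/-- The indices `v < 3 ^ j` all of whose `j` base `3` digits lie in `D`. -/
def triadic (D : Finset ℕ) : ℕ → Finset ℕ
  | 0 => {0}
  | j + 1 => (triadic D j ×ˢ D).image fun p => 3 * p.1 + p.2

lemma mem_triadic_succ {D : Finset ℕ} (hD : ∀ d ∈ D, d < 3) {j v : ℕ} :
    v ∈ triadic D (j + 1) ↔ v / 3 ∈ triadic D j ∧ v % 3 ∈ D := by
  simp only [triadic, Finset.mem_image, Finset.mem_product, Prod.exists]
  constructor
  · rintro ⟨u, d, ⟨hu, hd⟩, rfl⟩
    have := hD d hd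
    rw [show (3 * u + d) / 3 = u by omega, show (3 * u + d) % 3 = d by omega]
    exact ⟨hu, hd⟩
  · rintro ⟨hu, hd⟩
    exact ⟨v / 3, v % 3, ⟨hu, hd⟩, by omega⟩

lemma mem_triadic_add {D : Finset ℕ} (hD : ∀ d ∈ D, d < 3) {j i v : ℕ} :
    v ∈ triadic D (j + i) ↔ v / 3 ^ i ∈ triadic D j ∧ v % 3 ^ i ∈ triadic D i := by
  induction i generalizing v with
  | zero => simp [triadic, Nat.mod_one]
  | succ i ih =>
    rw [← add_assoc, mem_triadic_succ hD, ih, mem_triadic_succ hD, pow_succ',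
      Nat.div_div_eq_div_mul, Nat.mod_mul_right_div_self,
      Nat.mod_mod_of_dvd _ (Dvd.intro _ rfl), and_assoc]

lemma lt_pow_of_mem_triadic {D : Finset ℕ} (hD : ∀ d ∈ D, d < 3) {j v : ℕ}
    (hv : v ∈ triadic D j) : v < 3 ^ j := by
  induction j generalizing v with
  | zero => simp_all [triadic]
  | succ j ih =>
    have := ih ((mem_triadic_succ hD).1 hv).1
    rw [pow_succ]; omega

lemma div_mem_triadic {D : Finset ℕ} (hD : ∀ d ∈ D, d < 3) {j J v : ℕ} (hj : j ≤ J)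
    (hv : v ∈ triadic D J) : v / 3 ^ (J - j) ∈ triadic D j := by
  obtain ⟨i, rfl⟩ := Nat.exists_eq_add_of_le hj
  rw [Nat.add_sub_cancel_left]
  exact ((mem_triadic_add hD).1 hv).1

lemma card_triadic {D : Finset ℕ} (hD : ∀ d ∈ D, d < 3) (j : ℕ) :
    (triadic D j).card = D.card ^ j := by
  induction j with
  | zero => simp [triadic]
  | succ j ih =>
    rw [triadic, Finset.card_image_of_injOn, Finset.card_product, ih, pow_succ]
    rintro ⟨u, d⟩ h ⟨u', d'⟩ h' he
    simp only [Finset.coe_product, Set.mem_prod, Finset.mem_coe] at h h'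
    have := hD _ h.2
    have := hD _ h'.2
    simp only at he
    ext <;> simp only <;> omega

lemma card_triadic_fiber {D : Finset ℕ} (hD : ∀ d ∈ D, d < 3) {j J u : ℕ} (hj : j ≤ J)
    (hu : u ∈ triadic D j) :
    ((triadic D J).filter fun v => v / 3 ^ (J - j) = u).card = D.card ^ (J - j) := by
  obtain ⟨i, rfl⟩ := Nat.exists_eq_add_of_le hj
  rw [Nat.add_sub_cancel_left, ← card_triadic hD i]
  have hp : 0 < 3 ^ i := by positivity
  refine Finset.card_bij' (fun v _ => v % 3 ^ i) (fun w _ => 3 ^ i * u + w) ?_ ?_ ?_ ?_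
  · intro v hv
    exact ((mem_triadic_add hD).1 (Finset.mem_filter.1 hv).1).2
  · intro w hw
    have hlt := lt_pow_of_mem_triadic hD hw
    have h1 : (3 ^ i * u + w) / 3 ^ i = u := by
      rw [Nat.mul_add_div hp, Nat.div_eq_of_lt hlt, add_zero]
    rw [Finset.mem_filter, mem_triadic_add hD, h1, Nat.mul_add_mod, Nat.mod_eq_of_lt hlt]
    exact ⟨⟨hu, hw⟩, rfl⟩
  · intro v hv
    rw [← (Finset.mem_filter.1 hv).2]
    exact Nat.div_add_mod _ _
  · intro w hw
    simp [Nat.mod_eq_of_lt (lt_pow_of_mem_triadic hD hw)]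

/-! ### Triadic intervals and the Cantor set -/

/-- The index of the level `J` triadic interval containing the fractional part of `t`. -/
noncomputable def triadicIndex (J : ℕ) (t : ℝ) : ℕ := ⌊3 ^ J * Int.fract t⌋₊

lemma triadicIndex_lt (J : ℕ) (t : ℝ) : triadicIndex J t < 3 ^ J := by
  rw [triadicIndex, Nat.floor_lt (by positivity [Int.fract_nonneg t])]
  push_cast
  exact mul_lt_of_lt_one_right (by positivity) (Int.fract_lt_one t)

lemma measurable_triadicIndex (J : ℕ) : Measurable (triadicIndex J) :=
  Nat.measurable_floor.comp (measurable_fract.const_mul _)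

lemma triadicIndex_add_one (J : ℕ) (t : ℝ) : triadicIndex J (t + 1) = triadicIndex J t := by
  simp [triadicIndex]

lemma triadicIndex_div_le (J : ℕ) (t : ℝ) : (triadicIndex J t : ℝ) / 3 ^ J ≤ Int.fract t := by
  rw [div_le_iff₀ (by positivity), mul_comm]
  exact Nat.floor_le (mul_nonneg (by positivity) (Int.fract_nonneg t))

lemma lt_triadicIndex_div (J : ℕ) (t : ℝ) :
    Int.fract t < ((triadicIndex J t : ℝ) + 1) / 3 ^ J := by
  rw [lt_div_iff₀ (by positivity), mul_comm]
  exact Nat.lt_floor_add_one _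

/-- The closed triadic interval of level `j` and index `v`. -/
def triadicIcc (j v : ℕ) : Set ℝ := Set.Icc ((v : ℝ) / 3 ^ j) (((v : ℝ) + 1) / 3 ^ j)

lemma fract_mem_triadicIcc (J : ℕ) (t : ℝ) : Int.fract t ∈ triadicIcc J (triadicIndex J t) :=
  ⟨triadicIndex_div_le J t, (lt_triadicIndex_div J t).le⟩

lemma triadicIcc_subset_div {j J : ℕ} (hj : j ≤ J) (v : ℕ) :
    triadicIcc J v ⊆ triadicIcc j (v / 3 ^ (J - j)) := by
  obtain ⟨i, rfl⟩ := Nat.exists_eq_add_of_le hj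
  rw [Nat.add_sub_cancel_left]
  have h1 : ((3 ^ i * (v / 3 ^ i) : ℕ) : ℝ) ≤ v := by exact_mod_cast Nat.mul_div_le v _
  have h2 : (v : ℝ) + 1 ≤ ((3 ^ i * (v / 3 ^ i + 1) : ℕ) : ℝ) := by
    exact_mod_cast Nat.lt_mul_div_succ v (by positivity)
  push_cast at h1 h2
  refine Set.Icc_subset_Icc ?_ ?_
  · rw [div_le_div_iff₀ (by positivity) (by positivity), pow_add]
    nlinarith [show (0 : ℝ) < 3 ^ j by positivity]
  · rw [div_le_div_iff₀ (by positivity) (by positivity), pow_add]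
    nlinarith [show (0 : ℝ) < 3 ^ j by positivity]

lemma abs_sub_le_of_mem_triadicIcc {j v : ℕ} {x y : ℝ} (hx : x ∈ triadicIcc j v)
    (hy : y ∈ triadicIcc j v) : |x - y| ≤ (1 / 3 : ℝ) ^ j := by
  have h := add_div (v : ℝ) 1 (3 ^ j)
  have := hx.1; have := hx.2; have := hy.1; have := hy.2
  rw [one_div_pow, abs_le]
  constructor <;> linarith

lemma isCompact_triadicIcc (j v : ℕ) : IsCompact (triadicIcc j v) := isCompact_Icc

lemma triadicIcc_nonempty (j v : ℕ) : (triadicIcc j v).Nonempty :=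
  Set.nonempty_Icc.2 (by gcongr; linarith)

/-- The recursion for `preCantorSet` prepends a leading digit, whereas `triadic` appends a last one;
`mem_triadic_add` at `1 + j` reconciles the two. -/
lemma preCantorSet_eq_biUnion (j : ℕ) :
    preCantorSet j = ⋃ v ∈ triadic {0, 2} j, triadicIcc j v := by
  have hD : ∀ d ∈ ({0, 2} : Finset ℕ), d < 3 := by decide
  induction j with
  | zero => simp [triadic, triadicIcc]
  | succ j ih =>
    have h1 : triadic {0, 2} 1 = {0, 2} := by decide
    ext x
    simp only [preCantorSet_succ, ih, Set.mem_union, Set.mem_image, Set.mem_iUnion, exists_prop]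
    have hpos : (0 : ℝ) < 3 ^ j := by positivity
    have hposN : 0 < 3 ^ j := by positivity
    constructor
    · rintro (⟨y, ⟨v, hv, hy⟩, rfl⟩ | ⟨y, ⟨v, hv, hy⟩, rfl⟩)
      · have hlt := lt_pow_of_mem_triadic hD hv
        refine ⟨v, ?_, ?_⟩
        · rw [add_comm, mem_triadic_add hD, h1, Nat.div_eq_of_lt hlt, Nat.mod_eq_of_lt hlt]
          simp [hv]
        · simp only [triadicIcc, Set.mem_Icc, pow_succ] at hy ⊢
          rw [div_le_iff₀ hpos, le_div_iff₀ hpos] at hy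
          rw [div_le_iff₀ (by positivity), le_div_iff₀ (by positivity)]
          constructor <;> linarith [hy.1, hy.2]
      · have hlt := lt_pow_of_mem_triadic hD hv
        refine ⟨3 ^ j * 2 + v, ?_, ?_⟩
        · rw [add_comm, mem_triadic_add hD, h1, Nat.mul_add_div hposN, Nat.div_eq_of_lt hlt,
            Nat.mul_add_mod, Nat.mod_eq_of_lt hlt]
          simp [hv]
        · simp only [triadicIcc, Set.mem_Icc, pow_succ] at hy ⊢
          rw [div_le_iff₀ hpos, le_div_iff₀ hpos] at hy
          rw [div_le_iff₀ (by positivity), le_div_iff₀ (by positivity)]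
          push_cast
          constructor <;> linarith [hy.1, hy.2]
    · rintro ⟨v, hv, hx⟩
      rw [add_comm, mem_triadic_add hD, h1] at hv
      have hdm := Nat.div_add_mod v (3 ^ j)
      simp only [triadicIcc, Set.mem_Icc, pow_succ] at hx ⊢
      rw [div_le_iff₀ (by positivity), le_div_iff₀ (by positivity)] at hx
      simp only [Finset.mem_insert, Finset.mem_singleton] at hv
      obtain ⟨h0 | h0, hv⟩ := hv
      · rw [h0, mul_zero, zero_add] at hdm
        rw [hdm] at hv
        refine Or.inl ⟨3 * x, ⟨v, hv, ?_⟩, by ring⟩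
        rw [div_le_iff₀ hpos, le_div_iff₀ hpos]
        constructor <;> linarith [hx.1, hx.2]
      · rw [h0] at hdm
        have hc : (3 : ℝ) ^ j * 2 + ((v % 3 ^ j : ℕ) : ℝ) = v := by exact_mod_cast hdm
        refine Or.inr ⟨3 * x - 2, ⟨_, hv, ?_⟩, by ring⟩
        rw [div_le_iff₀ hpos, le_div_iff₀ hpos]
        constructor <;> linarith [hx.1, hx.2]

/-! ### Quasi-independence of the points `a n α` -/

/-- The integrand has period `1 / b`. Rounding the interval up to a whole number of periods costs at
most one extra period. -/
lemma integral_periodic_comp_mul_le {φ : ℝ → ℝ} (hper : Function.Periodic φ 1)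
    (hint : ∀ s t, IntervalIntegrable φ volume s t) (h0 : ∀ x, 0 ≤ φ x) {b : ℕ} (hb : 0 < b)
    (x : ℝ) {l : ℝ} (hl : 0 ≤ l) :
    ∫ t in x..x + l, φ (b * t) ≤ (l + 1 / b) * ∫ t in (0 : ℝ)..1, φ t := by
  have hb' : (0 : ℝ) < b := by exact_mod_cast hb
  set k := ⌈b * l⌉₊ with hk
  have hlk : l ≤ k / b := by
    rw [le_div_iff₀ hb', mul_comm]; exact Nat.le_ceil _
  have hI : 0 ≤ ∫ t in (0 : ℝ)..1, φ t :=
    intervalIntegral.integral_nonneg zero_le_one fun t _ => h0 t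
  have hcomp : IntervalIntegrable (fun t => φ (b * t)) volume x (x + k / b) := by
    have := (hint (b * x) (b * (x + k / b))).comp_mul_left (c := b)
    rwa [mul_div_cancel_left₀ _ hb'.ne', mul_div_cancel_left₀ _ hb'.ne'] at this
  calc ∫ t in x..x + l, φ (b * t) ≤ ∫ t in x..x + k / b, φ (b * t) :=
        intervalIntegral.integral_mono_interval le_rfl (by linarith) (by linarith)
          (ae_of_all _ fun t => h0 _) hcomp
    _ = (k / b) * ∫ t in (0 : ℝ)..1, φ t := by
        rw [intervalIntegral.integral_comp_mul_left _ hb'.ne', mul_add, mul_div_cancel₀ _ hb'.ne']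
        have := hper.intervalIntegral_add_zsmul_eq k (b * x) hint
        simp only [zsmul_eq_mul, mul_one, Int.cast_natCast] at this
        rw [this, hper.intervalIntegral_add_eq (b * x) 0, zero_add, smul_eq_mul]
        field_simp
    _ ≤ (l + 1 / b) * ∫ t in (0 : ℝ)..1, φ t := by
        gcongr
        have := (Nat.ceil_lt_add_one (show 0 ≤ b * l by positivity)).le
        rw [div_le_iff₀ hb', add_mul, div_mul_cancel₀ _ hb'.ne']
        linarith

lemma sum_range_mul_mod (F : ℕ → ℝ) (a m : ℕ) :
    ∑ i ∈ Finset.range (a * m), F (i % m) = a * ∑ v ∈ Finset.range m, F v := by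
  induction a with
  | zero => simp
  | succ a ih =>
    rw [add_mul, one_mul, Finset.sum_range_add, ih, Nat.cast_add, add_mul, Nat.cast_one, one_mul]
    congr 1
    refine Finset.sum_congr rfl fun i hi => ?_
    rw [Nat.mul_add_mod_self_right, Nat.mod_eq_of_lt (Finset.mem_range.1 hi)]

lemma triadicIndex_mul_of_mem {a : ℕ} (ha : 0 < a) {J i : ℕ} {t : ℝ}
    (h1 : (i : ℝ) / (a * 3 ^ J) ≤ t) (h2 : t < ((i : ℝ) + 1) / (a * 3 ^ J)) :
    triadicIndex J (a * t) = i % 3 ^ J := by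
  have ha' : (0 : ℝ) < a := by exact_mod_cast ha
  have hp : (0 : ℝ) < 3 ^ J := by positivity
  rw [div_le_iff₀ (by positivity)] at h1
  rw [lt_div_iff₀ (by positivity)] at h2
  have hdm : (3 : ℝ) ^ J * ((i / 3 ^ J : ℕ) : ℝ) + ((i % 3 ^ J : ℕ) : ℝ) = i := by
    exact_mod_cast Nat.div_add_mod i (3 ^ J)
  have hmod : ((i % 3 ^ J : ℕ) : ℝ) + 1 ≤ 3 ^ J := by
    exact_mod_cast Nat.mod_lt i (show 3 ^ J > 0 by positivity)
  have hfl : ⌊(a : ℝ) * t⌋ = ((i / 3 ^ J : ℕ) : ℤ) := by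
    rw [Int.floor_eq_iff, Int.cast_natCast]
    have hm0 : (0 : ℝ) ≤ ((i % 3 ^ J : ℕ) : ℝ) := by positivity
    constructor
    · refine le_of_mul_le_mul_left ?_ hp
      nlinarith
    · refine lt_of_mul_lt_mul_left ?_ hp.le
      nlinarith
  rw [triadicIndex, Nat.floor_eq_iff (mul_nonneg hp.le (Int.fract_nonneg _)), Int.fract, hfl,
    Int.cast_natCast]
  constructor <;> nlinarith

/-- The index of `a t` is constant on each cell of length `1 / (a * 3 ^ J)`, where it equals the
number of the cell modulo `3 ^ J`. -/
lemma integral_triadicIndex_mul (F : ℕ → ℝ) {a : ℕ} (ha : 0 < a) (J : ℕ) {g : ℝ → ℝ}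
    (hg : ∀ s t, IntervalIntegrable g volume s t) :
    ∫ t in (0 : ℝ)..1, F (triadicIndex J (a * t)) * g t =
      ∑ i ∈ Finset.range (a * 3 ^ J), F (i % 3 ^ J) *
        ∫ t in (i : ℝ) / (a * 3 ^ J)..(i : ℝ) / (a * 3 ^ J) + 1 / (a * 3 ^ J), g t := by
  have ha' : (0 : ℝ) < a := by exact_mod_cast ha
  have hm : (0 : ℝ) < a * 3 ^ J := by positivity
  have hcell : ∀ i : ℕ, Set.EqOn (fun t => F (triadicIndex J (a * t)) * g t)
      (fun t => F (i % 3 ^ J) * g t)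
      (Set.Ioo ((i : ℝ) / (a * 3 ^ J)) (((i + 1 : ℕ) : ℝ) / (a * 3 ^ J))) := by
    intro i t ht
    simp only
    rw [triadicIndex_mul_of_mem ha ht.1.le (by exact_mod_cast ht.2)]
  have hle : ∀ i : ℕ, (i : ℝ) / (a * 3 ^ J) ≤ ((i + 1 : ℕ) : ℝ) / (a * 3 ^ J) := by
    intro i; gcongr; simp
  have hsum := intervalIntegral.sum_integral_adjacent_intervals (μ := volume)
    (f := fun t => F (triadicIndex J (a * t)) * g t)
    (a := fun i : ℕ => (i : ℝ) / (a * 3 ^ J)) (n := a * 3 ^ J) (fun i _ => by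
      refine IntervalIntegrable.congr_ae (f := fun t => F (i % 3 ^ J) * g t)
        ((hg _ _).const_mul _) ?_
      rw [Set.uIoc_of_le (hle i), ← restrict_Ioo_eq_restrict_Ioc]
      exact (ae_restrict_iff' measurableSet_Ioo).2
        (ae_of_all _ fun t ht => (hcell i ht).symm))
  simp only [Nat.cast_zero, zero_div] at hsum
  rw [show (((a * 3 ^ J : ℕ) : ℝ)) / (a * 3 ^ J) = 1 by push_cast; field_simp] at hsum
  rw [← hsum]
  refine Finset.sum_congr rfl fun i _ => ?_
  rw [← add_div, ← intervalIntegral.integral_const_mul]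
  rw [show ((i : ℝ) + 1) = ((i + 1 : ℕ) : ℝ) by push_cast; rfl,
    intervalIntegral.integral_of_le (hle i), intervalIntegral.integral_of_le (hle i),
    integral_Ioc_eq_integral_Ioo, integral_Ioc_eq_integral_Ioo]
  exact setIntegral_congr_fun measurableSet_Ioo (hcell i)

/-- The set of `α` for which `a α` lies, modulo `1`, in a level `J` triadic interval with index
in `B`. -/
def hitSet (a J : ℕ) (B : Finset ℕ) : Set ℝ := {α | triadicIndex J (a * α) ∈ B}

lemma measurableSet_hitSet (a J : ℕ) (B : Finset ℕ) : MeasurableSet (hitSet a J B) :=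
  ((measurable_triadicIndex J).comp (measurable_const_mul _)) (Set.to_countable _).measurableSet

/-- Lebesgue measure on the unit interval. -/
noncomputable abbrev unitVolume : Measure ℝ := volume.restrict (Set.Ioc 0 1)

instance : IsProbabilityMeasure unitVolume := ⟨by simp⟩

lemma measureReal_hitSet_inter (S : Set ℝ) (hS : MeasurableSet S) (a J : ℕ) (B : Finset ℕ) :
    unitVolume.real (hitSet a J B ∩ S) = ∫ t in (0 : ℝ)..1,
      (if triadicIndex J (a * t) ∈ B then 1 else 0) * S.indicator 1 t := by
  rw [intervalIntegral.integral_of_le zero_le_one,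
    ← integral_indicator_one ((measurableSet_hitSet a J B).inter hS)]
  congr 1
  ext t
  rw [Set.inter_indicator_one]
  simp [Set.indicator, hitSet]

lemma sum_range_ite_mem {m : ℕ} {B : Finset ℕ} (hB : ∀ v ∈ B, v < m) :
    ∑ v ∈ Finset.range m, (if v ∈ B then (1 : ℝ) else 0) = B.card := by
  rw [Finset.sum_ite_mem, Finset.sum_const, nsmul_eq_mul, mul_one, Finset.inter_eq_right.2]
  exact fun v hv => Finset.mem_range.2 (hB v hv)

lemma measureReal_hitSet {a : ℕ} (ha : 0 < a) {J : ℕ} {B : Finset ℕ} (hB : ∀ v ∈ B, v < 3 ^ J) :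
    unitVolume.real (hitSet a J B) = B.card / 3 ^ J := by
  have ha' : (0 : ℝ) < a := by exact_mod_cast ha
  have h := measureReal_hitSet_inter Set.univ MeasurableSet.univ a J B
  rw [Set.inter_univ] at h
  rw [h, integral_triadicIndex_mul (fun v => if v ∈ B then 1 else 0) ha J (g := Set.univ.indicator 1)
    (by intro s t; rw [Set.indicator_univ]; exact intervalIntegrable_const (c := (1 : ℝ)))]
  simp only [Set.indicator_univ, Pi.one_apply, intervalIntegral.integral_const,
    add_sub_cancel_left, smul_eq_mul, mul_one]
  rw [← Finset.sum_mul, sum_range_mul_mod fun v => if v ∈ B then (1 : ℝ) else 0,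
    sum_range_ite_mem hB]
  field_simp

/-- The first event is constant on cells of length `1 / (a * 3 ^ J)`, the second has period `1 / b`.
On each cell the second takes at most its mean share of a length increased by `1 / b`, a relative
error of `3 ^ J * a / b`, which is small when `b` dominates. -/
lemma measureReal_hitSet_inter_le {a b : ℕ} (ha : 0 < a) (hb : 0 < b) {J J' : ℕ}
    {B B' : Finset ℕ} (hB : ∀ v ∈ B, v < 3 ^ J) (hB' : ∀ v ∈ B', v < 3 ^ J') :
    unitVolume.real (hitSet a J B ∩ hitSet b J' B') ≤
      (1 + 3 ^ J * a / b) * ((B.card / 3 ^ J) * (B'.card / 3 ^ J')) := by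
  have ha' : (0 : ℝ) < a := by exact_mod_cast ha
  have hb' : (0 : ℝ) < b := by exact_mod_cast hb
  set S : Set ℝ := hitSet 1 J' B' with hSdef
  have hSm : MeasurableSet S := measurableSet_hitSet _ _ _
  have hSb : hitSet b J' B' = {t | (b : ℝ) * t ∈ S} := by
    ext t; simp [hSdef, hitSet]
  have hind : ∀ s t, IntervalIntegrable (S.indicator (1 : ℝ → ℝ)) volume s t := fun s t =>
    ((intervalIntegrable_const (c := (1 : ℝ))).mono_fun
      ((measurable_one.indicator hSm).aestronglyMeasurable)
      (ae_of_all _ fun x => by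
        by_cases hx : x ∈ S <;> simp [hx]))
  have hindb : ∀ s t, IntervalIntegrable ((hitSet b J' B').indicator (1 : ℝ → ℝ)) volume s t :=
    fun s t => ((intervalIntegrable_const (c := (1 : ℝ))).mono_fun
      ((measurable_one.indicator (measurableSet_hitSet _ _ _)).aestronglyMeasurable)
      (ae_of_all _ fun x => by
        by_cases hx : x ∈ hitSet b J' B' <;> simp [hx]))
  have hper : Function.Periodic (S.indicator (1 : ℝ → ℝ)) 1 := by
    intro t
    have : t + 1 ∈ S ↔ t ∈ S := by
      simp [hSdef, hitSet, triadicIndex_add_one]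
    by_cases ht : t ∈ S
    · rw [Set.indicator_of_mem ht, Set.indicator_of_mem (this.2 ht)]; rfl
    · rw [Set.indicator_of_notMem ht, Set.indicator_of_notMem (mt this.1 ht)]
  have hmean : ∫ t in (0 : ℝ)..1, S.indicator (1 : ℝ → ℝ) t = B'.card / 3 ^ J' := by
    rw [← measureReal_hitSet one_pos hB', intervalIntegral.integral_of_le zero_le_one,
      ← integral_indicator_one hSm]
  rw [measureReal_hitSet_inter _ (measurableSet_hitSet _ _ _),
    integral_triadicIndex_mul (fun v => if v ∈ B then 1 else 0) ha J hindb]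
  calc _ ≤ ∑ i ∈ Finset.range (a * 3 ^ J), (if i % 3 ^ J ∈ B then (1 : ℝ) else 0) *
        ((1 / (a * 3 ^ J) + 1 / b) * (B'.card / 3 ^ J')) := by
        refine Finset.sum_le_sum fun i _ => mul_le_mul_of_nonneg_left ?_ (by split_ifs <;> simp)
        have := integral_periodic_comp_mul_le hper hind
          (fun x => Set.indicator_nonneg (fun _ _ => zero_le_one) x) hb ((i : ℝ) / (a * 3 ^ J))
          (l := 1 / (a * 3 ^ J)) (by positivity)
        rw [hmean] at this
        refine le_trans (le_of_eq ?_) this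
        rw [hSb]; rfl
    _ = _ := by
        rw [← Finset.sum_mul, sum_range_mul_mod fun v => if v ∈ B then (1 : ℝ) else 0,
          sum_range_ite_mem hB]
        field_simp

/-! ### Second moments, growth and scales -/

/-- In the expanded square the diagonal contributes the mean `Λ`, and the off-diagonal terms exceed
those of `Λ ^ 2` by a factor of at most `1 + ε`. -/
lemma integral_sq_sum_indicator_sub_le {Ω : Type*} [MeasurableSpace Ω] (P : Measure Ω)
    [IsProbabilityMeasure P] (S : Finset ℕ) {A : ℕ → Set Ω} (hA : ∀ n, MeasurableSet (A n))
    {ε : ℝ} (hε : 0 ≤ ε)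
    (hpair : ∀ n ∈ S, ∀ m ∈ S, n < m → P.real (A n ∩ A m) ≤ (1 + ε) * (P.real (A n) * P.real (A m))) :
    ∫ ω, (∑ n ∈ S, (A n).indicator 1 ω - ∑ n ∈ S, P.real (A n)) ^ 2 ∂P ≤
      ∑ n ∈ S, P.real (A n) + ε * (∑ n ∈ S, P.real (A n)) ^ 2 := by
  set Λ := ∑ n ∈ S, P.real (A n) with hΛ
  have hint : ∀ T : Set Ω, MeasurableSet T → Integrable (T.indicator (1 : Ω → ℝ)) P := fun T hT =>
    (integrable_const (1 : ℝ)).indicator hT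
  have hX : Integrable (fun ω => ∑ n ∈ S, (A n).indicator (1 : Ω → ℝ) ω) P :=
    integrable_finsetSum _ fun n _ => hint _ (hA n)
  have hXX : ∀ ω, (∑ n ∈ S, (A n).indicator (1 : Ω → ℝ) ω) ^ 2 =
      ∑ n ∈ S, ∑ m ∈ S, (A n ∩ A m).indicator (1 : Ω → ℝ) ω := by
    intro ω
    rw [sq, Finset.sum_mul_sum]
    simp [Set.inter_indicator_one]
  have hXXi : Integrable (fun ω => (∑ n ∈ S, (A n).indicator (1 : Ω → ℝ) ω) ^ 2) P := by
    simp_rw [hXX]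
    exact integrable_finsetSum _ fun n _ => integrable_finsetSum _ fun m _ =>
      hint _ ((hA n).inter (hA m))
  have h1 : ∫ ω, (∑ n ∈ S, (A n).indicator (1 : Ω → ℝ) ω) ∂P = Λ := by
    rw [integral_finsetSum _ fun n _ => hint _ (hA n)]
    exact Finset.sum_congr rfl fun n _ => integral_indicator_one (hA n)
  have h2 : ∫ ω, (∑ n ∈ S, (A n).indicator (1 : Ω → ℝ) ω) ^ 2 ∂P ≤ Λ + (1 + ε) * Λ ^ 2 := by
    simp_rw [hXX]
    rw [integral_finsetSum _ fun n _ => integrable_finsetSum _ fun m _ =>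
      hint _ ((hA n).inter (hA m))]
    have : ∀ n ∈ S, ∫ ω, ∑ m ∈ S, (A n ∩ A m).indicator (1 : Ω → ℝ) ω ∂P ≤
        P.real (A n) + (1 + ε) * (P.real (A n) * Λ) := by
      intro n hn
      rw [integral_finsetSum _ fun m _ => hint _ ((hA n).inter (hA m))]
      calc _ ≤ ∑ m ∈ S, ((if n = m then P.real (A n) else 0) +
            (1 + ε) * (P.real (A n) * P.real (A m))) := by
            refine Finset.sum_le_sum fun m hm => ?_
            rw [integral_indicator_one ((hA n).inter (hA m))]
            rcases lt_trichotomy n m with h | h | h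
            · simpa [h.ne] using hpair n hn m hm h
            · subst h
              simp only [Set.inter_self, if_true, le_add_iff_nonneg_right]
              positivity
            · rw [Set.inter_comm, mul_comm (P.real (A n))]
              simpa [h.ne'] using hpair m hm n hn h
        _ = _ := by
            rw [Finset.sum_add_distrib, Finset.sum_ite_eq, if_pos hn, ← Finset.mul_sum,
              ← Finset.mul_sum]
    calc _ ≤ ∑ n ∈ S, (P.real (A n) + (1 + ε) * (P.real (A n) * Λ)) := Finset.sum_le_sum this
      _ = _ := by
        rw [Finset.sum_add_distrib, ← Finset.mul_sum, ← Finset.sum_mul, ← hΛ]; ring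
  have h3 : ∀ ω, (∑ n ∈ S, (A n).indicator (1 : Ω → ℝ) ω - Λ) ^ 2 =
      (∑ n ∈ S, (A n).indicator (1 : Ω → ℝ) ω) ^ 2 -
        2 * Λ * (∑ n ∈ S, (A n).indicator (1 : Ω → ℝ) ω) + Λ ^ 2 := fun ω => by ring
  simp_rw [h3]
  have h4 := hXXi.sub (hX.const_mul (2 * Λ))
  simp only [Pi.sub_def] at h4
  rw [integral_add h4 (integrable_const _), integral_sub hXXi (hX.const_mul _), integral_const_mul, h1]
  simp only [integral_const, probReal_univ, smul_eq_mul, one_mul]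
  nlinarith

/-- The hypothesis gives the case `m = n + 1`; from then on the sequence is nondecreasing, so larger
`m` only help. -/
lemma eventually_rpow_mul_le_of_growth {a : ℕ → ℕ} (ha : ∀ n : ℕ, 1 ≤ n → 0 < a n)
    (hgrowth : Tendsto (fun n : ℕ => Real.log ((a (n + 1) : ℝ) / (a n : ℝ)) / Real.log (n : ℝ))
      atTop atTop) {C : ℝ} (hC : 0 ≤ C) :
    ∃ n₀ : ℕ, 1 ≤ n₀ ∧ ∀ n ≥ n₀, ∀ m > n, (n : ℝ) ^ C * a n ≤ a m := by
  obtain ⟨n₁, h₁⟩ := eventually_atTop.1 (hgrowth.eventually_ge_atTop C)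
  have hstep : ∀ n ≥ max n₁ 2, (n : ℝ) ^ C * a n ≤ a (n + 1) := by
    intro n hn
    have hn2 : 2 ≤ n := le_trans (le_max_right _ _) hn
    have hn' : (1 : ℝ) < n := by exact_mod_cast hn2
    have ha1 : (0 : ℝ) < a n := by exact_mod_cast ha n (by omega)
    have ha2 : (0 : ℝ) < a (n + 1) := by exact_mod_cast ha (n + 1) (by omega)
    have h := h₁ n (le_trans (le_max_left _ _) hn)
    rw [le_div_iff₀ (Real.log_pos hn'), ← Real.log_rpow (by linarith),
      Real.log_le_log_iff (by positivity) (by positivity), le_div_iff₀ ha1] at h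
    exact h
  refine ⟨max n₁ 2, le_trans one_le_two (le_max_right _ _), fun n hn m hm => ?_⟩
  induction m, hm using Nat.le_induction with
  | base => exact hstep n hn
  | succ m hm ih =>
    refine ih.trans (le_trans ?_ (hstep m (by omega)))
    have hn2 : 2 ≤ n := le_trans (le_max_right _ _) hn
    have hm1 : (1 : ℝ) ≤ m := by exact_mod_cast (by omega : 1 ≤ m)
    exact le_mul_of_one_le_left (Nat.cast_nonneg _) (Real.one_le_rpow hm1 hC)

/-- The largest level `j` with `3 ^ j ≤ n ^ ν`. -/
noncomputable def triadicLevel (ν : ℝ) (n : ℕ) : ℕ := ⌊ν * Real.logb 3 n⌋₊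

lemma pow_triadicLevel_le {ν : ℝ} (hν : 0 ≤ ν) {n : ℕ} (hn : 1 ≤ n) :
    (3 : ℝ) ^ triadicLevel ν n ≤ (n : ℝ) ^ ν := by
  have hn' : (1 : ℝ) ≤ n := by exact_mod_cast hn
  have h0 : 0 ≤ Real.logb 3 n := Real.logb_nonneg (by norm_num) hn'
  rw [← Real.rpow_natCast, ← Real.le_logb_iff_rpow_le (by norm_num) (by positivity),
    Real.logb_rpow_eq_mul_logb_of_pos (by linarith)]
  exact Nat.floor_le (by positivity)

lemma lt_pow_triadicLevel_add_one (ν : ℝ) {n : ℕ} (hn : 1 ≤ n) :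
    (n : ℝ) ^ ν < (3 : ℝ) ^ (triadicLevel ν n + 1) := by
  have hn' : (1 : ℝ) ≤ n := by exact_mod_cast hn
  rw [← Real.rpow_natCast, ← Real.logb_lt_iff_lt_rpow (by norm_num) (by positivity),
    Real.logb_rpow_eq_mul_logb_of_pos (by linarith)]
  push_cast
  exact Nat.lt_floor_add_one _

lemma ae_summable_of_summable_integral {Ω : Type*} [MeasurableSpace Ω] {P : Measure Ω}
    {f : ℕ → Ω → ℝ} (hf : ∀ i ω, 0 ≤ f i ω) (hint : ∀ i, Integrable (f i) P)
    (hsum : Summable fun i => ∫ ω, f i ω ∂P) : ∀ᵐ ω ∂P, Summable fun i => f i ω := by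
  have h1 : ∫⁻ ω, ∑' i, ENNReal.ofReal (f i ω) ∂P ≠ ⊤ := by
    rw [lintegral_tsum fun i => (hint i).aestronglyMeasurable.aemeasurable.ennreal_ofReal]
    have : ∀ i, ∫⁻ ω, ENNReal.ofReal (f i ω) ∂P = ENNReal.ofReal (∫ ω, f i ω ∂P) := fun i =>
      (ofReal_integral_eq_lintegral_ofReal (hint i) (ae_of_all _ (hf i))).symm
    simp_rw [this]
    rw [← ENNReal.ofReal_tsum_of_nonneg (fun i => integral_nonneg (hf i)) hsum]
    exact ENNReal.ofReal_ne_top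
  have h2 := ae_lt_top' (AEMeasurable.tsum fun i =>
    (hint i).aestronglyMeasurable.aemeasurable.ennreal_ofReal) h1
  filter_upwards [h2] with ω hω
  have := ENNReal.summable_toReal hω.ne
  simpa [ENNReal.toReal_ofReal, hf] using this

/-! ### Discrete energy and equidistribution of dyadic blocks -/

/-- The mass that a weight `w` on level `L` gives to the interval `u` of level `j ≤ L`. -/
noncomputable def levelMass (D : Finset ℕ) (L j : ℕ) (w : ℕ → ℝ) (u : ℕ) : ℝ :=
  ∑ v ∈ (triadic D L).filter fun v => v / 3 ^ (L - j) = u, w v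

/-- The discretised Riesz energy, truncated at level `L`, of a weight `w` on level `L`. -/
noncomputable def levelEnergy (D : Finset ℕ) (t : ℝ) (L : ℕ) (w : ℕ → ℝ) : ℝ :=
  ∑ j ∈ Finset.range (L + 1), t ^ j * ∑ u ∈ triadic D j, levelMass D L j w u ^ 2

/-- The normalised counting weight of the points `a n α`, `n ∈ S`, among level `J` intervals. -/
noncomputable def blockDensity (D : Finset ℕ) (a : ℕ → ℕ) (S : Finset ℕ) (J : ℕ) (α : ℝ) (v : ℕ) :
    ℝ :=
  3 ^ J / (D.card ^ J * S.card) * (S.filter fun n => triadicIndex J (a n * α) = v).card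

/-- The block density is normalised to have mean `(D.card ^ J)⁻¹` at every index, so its deviation
from the uniform weight is a centred count of hits, to which the variance bound applies. -/
lemma levelMass_blockDensity_sub {D : Finset ℕ} (hD : ∀ d ∈ D, d < 3) (hD0 : D.Nonempty)
    (a : ℕ → ℕ) (ha : ∀ n, 1 ≤ n → 0 < a n) {S : Finset ℕ} (hS : S.Nonempty)
    (hS1 : ∀ n ∈ S, 1 ≤ n) {j J u : ℕ} (α : ℝ) :
    levelMass D J j (fun v => blockDensity D a S J α v - ((D.card : ℝ) ^ J)⁻¹) u =
      3 ^ J / (D.card ^ J * S.card) *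
        (∑ n ∈ S, (hitSet (a n) J
          ((triadic D J).filter fun v => v / 3 ^ (J - j) = u)).indicator 1 α -
        ∑ n ∈ S, unitVolume.real (hitSet (a n) J
          ((triadic D J).filter fun v => v / 3 ^ (J - j) = u))) := by
  set B := (triadic D J).filter fun v => v / 3 ^ (J - j) = u with hB
  have hq : (0 : ℝ) < D.card := by exact_mod_cast hD0.card_pos
  have hS' : (0 : ℝ) < S.card := by exact_mod_cast hS.card_pos
  have hBlt : ∀ v ∈ B, v < 3 ^ J := fun v hv =>
    lt_pow_of_mem_triadic hD (Finset.mem_filter.1 hv).1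
  have h1 : ∑ n ∈ S, unitVolume.real (hitSet (a n) J B) = S.card * (B.card / 3 ^ J) := by
    rw [Finset.sum_congr rfl fun n hn => measureReal_hitSet (ha n (hS1 n hn)) hBlt,
      Finset.sum_const, nsmul_eq_mul]
  have h2 : ∑ v ∈ B, ((S.filter fun n => triadicIndex J (a n * α) = v).card : ℝ) =
      ∑ n ∈ S, (hitSet (a n) J B).indicator (1 : ℝ → ℝ) α := by
    simp only [Finset.card_filter, Nat.cast_sum]
    rw [Finset.sum_comm]
    refine Finset.sum_congr rfl fun n _ => ?_
    by_cases h : triadicIndex J (a n * α) ∈ B <;> simp [Set.indicator, hitSet, h]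
  rw [h1, ← h2, levelMass, ← hB, Finset.sum_sub_distrib, Finset.sum_const, nsmul_eq_mul, mul_sub,
    Finset.mul_sum]
  congr 1
  field_simp

lemma integrable_sq_sum_indicator_sub (a : ℕ → ℕ) (S : Finset ℕ) (J : ℕ) (B : Finset ℕ) (c Λ : ℝ) :
    Integrable (fun α => (c * (∑ n ∈ S, (hitSet (a n) J B).indicator (1 : ℝ → ℝ) α - Λ)) ^ 2)
      unitVolume := by
  refine Integrable.of_bound (C := (|c| * (S.card + |Λ|)) ^ 2) ?_ (ae_of_all _ fun α => ?_)
  · refine Measurable.aestronglyMeasurable ?_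
    have : ∀ n, Measurable ((hitSet (a n) J B).indicator (1 : ℝ → ℝ)) := fun n =>
      measurable_one.indicator (measurableSet_hitSet _ _ _)
    fun_prop
  · rw [Real.norm_eq_abs, abs_pow, abs_mul]
    gcongr
    refine (abs_sub _ _).trans ?_
    gcongr
    refine (Finset.abs_sum_le_sum_abs _ _).trans ?_
    rw [Finset.card_eq_sum_ones]
    push_cast
    refine Finset.sum_le_sum fun n _ => ?_
    by_cases h : α ∈ hitSet (a n) J B <;> simp [h]

lemma integrable_levelMass_blockDensity_sub {D : Finset ℕ} (hD : ∀ d ∈ D, d < 3)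
    (hD0 : D.Nonempty) (a : ℕ → ℕ) (ha : ∀ n, 1 ≤ n → 0 < a n) {S : Finset ℕ} (hS : S.Nonempty)
    (hS1 : ∀ n ∈ S, 1 ≤ n) {j J u : ℕ} :
    Integrable (fun α =>
      levelMass D J j (fun v => blockDensity D a S J α v - ((D.card : ℝ) ^ J)⁻¹) u ^ 2)
      unitVolume := by
  simp_rw [levelMass_blockDensity_sub hD hD0 a ha hS hS1]
  exact integrable_sq_sum_indicator_sub _ _ _ _ _ _

lemma integral_sq_levelMass_blockDensity_sub_le {D : Finset ℕ} (hD : ∀ d ∈ D, d < 3)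
    (hD0 : D.Nonempty) (a : ℕ → ℕ) (ha : ∀ n, 1 ≤ n → 0 < a n) {S : Finset ℕ} (hS : S.Nonempty)
    (hS1 : ∀ n ∈ S, 1 ≤ n) {J : ℕ} {ε : ℝ} (hε : 0 ≤ ε)
    (hsep : ∀ n ∈ S, ∀ m ∈ S, n < m → (3 : ℝ) ^ J * a n / a m ≤ ε)
    {j : ℕ} (hj : j ≤ J) {u : ℕ} (hu : u ∈ triadic D j) :
    ∫ α, levelMass D J j (fun v => blockDensity D a S J α v - ((D.card : ℝ) ^ J)⁻¹) u ^ 2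
        ∂unitVolume ≤
      3 ^ J / (D.card ^ J * S.card) * ((D.card : ℝ) ^ j)⁻¹ + ε * (((D.card : ℝ) ^ j)⁻¹) ^ 2 := by
  simp_rw [levelMass_blockDensity_sub hD hD0 a ha hS hS1, mul_pow]
  set B := (triadic D J).filter fun v => v / 3 ^ (J - j) = u with hB
  have hq : (0 : ℝ) < D.card := by exact_mod_cast hD0.card_pos
  have hS' : (0 : ℝ) < S.card := by exact_mod_cast hS.card_pos
  have hBlt : ∀ v ∈ B, v < 3 ^ J := fun v hv =>
    lt_pow_of_mem_triadic hD (Finset.mem_filter.1 hv).1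
  have h1 : ∑ n ∈ S, unitVolume.real (hitSet (a n) J B) = S.card * (B.card / 3 ^ J) := by
    rw [Finset.sum_congr rfl fun n hn => measureReal_hitSet (ha n (hS1 n hn)) hBlt,
      Finset.sum_const, nsmul_eq_mul]
  have hvar := integral_sq_sum_indicator_sub_le unitVolume S
    (A := fun n => hitSet (a n) J B) (fun n => measurableSet_hitSet _ _ _) hε
    (fun n hn m hm hnm => by
      rw [measureReal_hitSet (ha n (hS1 n hn)) hBlt, measureReal_hitSet (ha m (hS1 m hm)) hBlt]
      refine (measureReal_hitSet_inter_le (ha n (hS1 n hn)) (ha m (hS1 m hm)) hBlt hBlt).trans ?_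
      gcongr
      exact hsep n hn m hm hnm)
  rw [integral_const_mul]
  refine (mul_le_mul_of_nonneg_left hvar (by positivity)).trans (le_of_eq ?_)
  rw [h1, card_triadic_fiber hD hj hu]
  obtain ⟨i, rfl⟩ := Nat.exists_eq_add_of_le hj
  rw [Nat.add_sub_cancel_left]
  push_cast
  rw [pow_add (D.card : ℝ)]
  field_simp

lemma integrable_levelEnergy_blockDensity_sub {D : Finset ℕ} (hD : ∀ d ∈ D, d < 3)
    (hD0 : D.Nonempty) (a : ℕ → ℕ) (ha : ∀ n, 1 ≤ n → 0 < a n) {S : Finset ℕ} (hS : S.Nonempty)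
    (hS1 : ∀ n ∈ S, 1 ≤ n) (J : ℕ) (t : ℝ) :
    Integrable (fun α =>
      levelEnergy D t J (fun v => blockDensity D a S J α v - ((D.card : ℝ) ^ J)⁻¹)) unitVolume :=
  integrable_finsetSum _ fun _ _ => (integrable_finsetSum _ fun _ _ =>
    integrable_levelMass_blockDensity_sub hD hD0 a ha hS hS1).const_mul _

/-- Summing the variances over level `j` gives a diagonal part proportional to `t ^ j`, dominated by
the finest level since `t > 1`, and a correlation part `ε * (t / D.card) ^ j`, a convergent
geometric series since `t < D.card`. -/
lemma integral_levelEnergy_blockDensity_sub_le {D : Finset ℕ} (hD : ∀ d ∈ D, d < 3)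
    (hD0 : D.Nonempty) (a : ℕ → ℕ) (ha : ∀ n, 1 ≤ n → 0 < a n) {S : Finset ℕ} (hS : S.Nonempty)
    (hS1 : ∀ n ∈ S, 1 ≤ n) {J : ℕ} {ε : ℝ} (hε : 0 ≤ ε)
    (hsep : ∀ n ∈ S, ∀ m ∈ S, n < m → (3 : ℝ) ^ J * a n / a m ≤ ε) {t : ℝ} (ht1 : 1 < t)
    (htq : t < D.card) :
    ∫ α, levelEnergy D t J (fun v => blockDensity D a S J α v - ((D.card : ℝ) ^ J)⁻¹)
        ∂unitVolume ≤
      t / (t - 1) * ((3 * t / D.card) ^ J / S.card) + ε * (D.card / (D.card - t)) := by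
  have hq : (0 : ℝ) < D.card := by exact_mod_cast hD0.card_pos
  have hS' : (0 : ℝ) < S.card := by exact_mod_cast hS.card_pos
  set c : ℝ := 3 ^ J / (D.card ^ J * S.card) with hc
  have hc0 : 0 ≤ c := by positivity
  have hi : ∀ j ∈ Finset.range (J + 1), ∀ u ∈ triadic D j, Integrable (fun α =>
      levelMass D J j (fun v => blockDensity D a S J α v - ((D.card : ℝ) ^ J)⁻¹) u ^ 2)
      unitVolume := fun j _ u _ =>
    integrable_levelMass_blockDensity_sub hD hD0 a ha hS hS1
  simp only [levelEnergy]
  rw [integral_finsetSum _ fun j hj => (integrable_finsetSum _ (hi j hj)).const_mul _]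
  have hj : ∀ j ∈ Finset.range (J + 1), ∫ α, t ^ j * ∑ u ∈ triadic D j,
      levelMass D J j (fun v => blockDensity D a S J α v - ((D.card : ℝ) ^ J)⁻¹) u ^ 2 ∂unitVolume
      ≤ c * t ^ j + ε * (t / D.card) ^ j := by
    intro j hj
    rw [integral_const_mul, integral_finsetSum _ (hi j hj)]
    calc _ ≤ t ^ j * ∑ u ∈ triadic D j,
          (c * ((D.card : ℝ) ^ j)⁻¹ + ε * (((D.card : ℝ) ^ j)⁻¹) ^ 2) := by
          gcongr with u hu
          exact integral_sq_levelMass_blockDensity_sub_le hD hD0 a ha hS hS1 hε hsep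
            (Nat.lt_succ_iff.1 (Finset.mem_range.1 hj)) hu
      _ = _ := by
          rw [Finset.sum_const, card_triadic hD, nsmul_eq_mul, div_pow]
          push_cast
          field_simp
  refine (Finset.sum_le_sum hj).trans ?_
  rw [Finset.sum_add_distrib, ← Finset.mul_sum, ← Finset.mul_sum]
  refine add_le_add ?_ (mul_le_mul_of_nonneg_left ?_ hε)
  · rw [geom_sum_eq ht1.ne']
    calc c * ((t ^ (J + 1) - 1) / (t - 1)) ≤ c * (t ^ (J + 1) / (t - 1)) := by
          have : 0 < t - 1 := by linarith
          gcongr; linarith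
      _ = _ := by
          rw [hc, div_pow, mul_pow, pow_succ]
          field_simp
  · have h1 : t / D.card < 1 := (div_lt_one hq).2 htq
    have h0 : 0 ≤ t / D.card := by positivity
    refine (Summable.sum_le_tsum _ (fun i _ => pow_nonneg h0 i)
      (summable_geometric_of_lt_one h0 h1)).trans (le_of_eq ?_)
    rw [tsum_geometric_of_lt_one h0 h1, one_sub_div hq.ne', inv_div]

lemma levelEnergy_nonneg (D : Finset ℕ) {t : ℝ} (ht : 0 ≤ t) (L : ℕ) (w : ℕ → ℝ) :
    0 ≤ levelEnergy D t L w :=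
  Finset.sum_nonneg fun _ _ => mul_nonneg (pow_nonneg ht _)
    (Finset.sum_nonneg fun _ _ => sq_nonneg _)

/-- For almost every `α`, the blocks `a n α`, `2 ^ i ≤ n < 2 ^ (i + 1)`, are asymptotically
equidistributed on the self-similar set in the energy norm. -/
lemma ae_tendsto_levelEnergy_blockDensity {D : Finset ℕ} (hD : ∀ d ∈ D, d < 3) (hD0 : D.Nonempty)
    {a : ℕ → ℕ} (ha : ∀ n, 1 ≤ n → 0 < a n)
    (hgrowth : Tendsto (fun n : ℕ => Real.log ((a (n + 1) : ℝ) / (a n : ℝ)) / Real.log (n : ℝ))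
      atTop atTop) {t ν : ℝ} (ht1 : 1 < t) (htq : t < D.card) (hq3 : D.card ≤ 3) (hν : 0 ≤ ν)
    (hνt : ν * Real.logb 3 (3 * t / D.card) < 1) :
    ∀ᵐ α ∂unitVolume, Tendsto (fun i : ℕ => levelEnergy D t (triadicLevel ν (2 ^ (i + 1)) + 1)
      (fun v => blockDensity D a (Finset.Ico (2 ^ i) (2 ^ (i + 1)))
        (triadicLevel ν (2 ^ (i + 1)) + 1) α v -
          ((D.card : ℝ) ^ (triadicLevel ν (2 ^ (i + 1)) + 1))⁻¹)) atTop (nhds 0) := by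
  have hq : (0 : ℝ) < D.card := by exact_mod_cast hD0.card_pos
  set θ := Real.logb 3 (3 * t / D.card) with hθ
  have hq3' : (D.card : ℝ) ≤ 3 := by exact_mod_cast hq3
  have hθ0 : 0 ≤ θ := Real.logb_nonneg (by norm_num) (by rw [le_div_iff₀ hq]; linarith)
  have hρ : 3 * t / D.card = (3 : ℝ) ^ θ := by
    rw [hθ, Real.rpow_logb (by norm_num) (by norm_num) (by positivity)]
  -- The upper end of the block and the extra `+ 1` make `(1 / 3) ^ J i` smaller than `1 / n ^ ν`
  -- for every `n` in the block.
  set J : ℕ → ℕ := fun i => triadicLevel ν (2 ^ (i + 1)) + 1 with hJ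
  set S : ℕ → Finset ℕ := fun i => Finset.Ico (2 ^ i) (2 ^ (i + 1)) with hSdef
  have hcard : ∀ i, (S i).card = 2 ^ i := fun i => by simp [hSdef, pow_succ]; omega
  have hSne : ∀ i, (S i).Nonempty := fun i => by
    rw [← Finset.card_pos, hcard]; positivity
  have hS1 : ∀ i, ∀ n ∈ S i, 1 ≤ n := fun i n hn =>
    le_trans Nat.one_le_two_pow (Finset.mem_Ico.1 hn).1
  have hJle : ∀ i, (3 : ℝ) ^ J i ≤ 3 * ((2 : ℝ) ^ ν * ((2 : ℝ) ^ i) ^ ν) := by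
    intro i
    have := pow_triadicLevel_le hν (n := 2 ^ (i + 1)) Nat.one_le_two_pow
    rw [hJ, pow_succ, mul_comm]
    refine mul_le_mul_of_nonneg_left (this.trans (le_of_eq ?_)) (by norm_num)
    push_cast
    rw [pow_succ', Real.mul_rpow (by norm_num) (by positivity)]
  -- The part `ν` of the exponent absorbs `3 ^ J i`; the remaining `1` leaves the summable error `2
  -- ^ (-i)`.
  obtain ⟨n₀, -, hn₀⟩ := eventually_rpow_mul_le_of_growth ha hgrowth (C := ν + 1) (by linarith)
  have hsummable : Summable fun i => ∫ α, levelEnergy D t (J i)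
      (fun v => blockDensity D a (S i) (J i) α v - ((D.card : ℝ) ^ J i)⁻¹) ∂unitVolume := by
    have hb : ∀ᶠ i in atTop, ∫ α, levelEnergy D t (J i)
        (fun v => blockDensity D a (S i) (J i) α v - ((D.card : ℝ) ^ J i)⁻¹) ∂unitVolume ≤
        t / (t - 1) * ((3 * (2 : ℝ) ^ ν) ^ θ * ((2 : ℝ) ^ (ν * θ - 1)) ^ i) +
          3 * (2 : ℝ) ^ ν * (D.card / (D.card - t)) * (1 / 2) ^ i := by
      filter_upwards [eventually_ge_atTop n₀] with i hi
      have hni : n₀ ≤ 2 ^ i := hi.trans Nat.lt_two_pow_self.le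
      have h := integral_levelEnergy_blockDensity_sub_le hD hD0 a ha (hSne i) (hS1 i) (J := J i)
        (ε := 3 * (2 : ℝ) ^ ν * (1 / 2) ^ i) (by positivity) (fun n hn m hm hnm => by
          have hn1 := Finset.mem_Ico.1 hn
          have hg := hn₀ n (hni.trans hn1.1) m hnm
          have han : (0 : ℝ) < a n := by exact_mod_cast ha n (hS1 i n hn)
          have ham : (0 : ℝ) < a m := by exact_mod_cast ha m (hS1 i m hm)
          have h2n : (2 : ℝ) ^ i ≤ n := by exact_mod_cast hn1.1
          have h2i : (0 : ℝ) < (2 : ℝ) ^ i := by positivity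
          rw [div_le_iff₀ ham]
          have hpow : ((2 : ℝ) ^ i) ^ ν * (2 : ℝ) ^ i * a n ≤ a m := by
            refine le_trans ?_ hg
            gcongr
            rw [← Real.rpow_add_one h2i.ne']
            gcongr
          calc (3 : ℝ) ^ J i * a n ≤ 3 * ((2 : ℝ) ^ ν * ((2 : ℝ) ^ i) ^ ν) * a n := by
                gcongr; exact hJle i
            _ = 3 * (2 : ℝ) ^ ν * (1 / 2) ^ i * (((2 : ℝ) ^ i) ^ ν * (2 : ℝ) ^ i * a n) := by
                rw [one_div_pow]; field_simp
            _ ≤ _ := by gcongr) ht1 htq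
      refine h.trans (add_le_add ?_ (le_of_eq (by ring)))
      have ht' : 0 < t - 1 := by linarith
      refine mul_le_mul_of_nonneg_left ?_ (by positivity)
      rw [hcard, hρ, ← Real.rpow_natCast, ← Real.rpow_mul (by norm_num), mul_comm θ,
        Real.rpow_mul (by norm_num), Real.rpow_natCast]
      have h2i : (0 : ℝ) < (2 : ℝ) ^ i := by positivity
      calc ((3 : ℝ) ^ J i) ^ θ / ((2 ^ i : ℕ) : ℝ)
          ≤ (3 * ((2 : ℝ) ^ ν * ((2 : ℝ) ^ i) ^ ν)) ^ θ / ((2 ^ i : ℕ) : ℝ) := by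
            gcongr; exact hJle i
        _ = _ := by
            push_cast
            rw [← mul_assoc, Real.mul_rpow (by positivity) (by positivity), mul_div_assoc,
              ← Real.rpow_mul h2i.le, ← Real.rpow_sub_one h2i.ne',
              ← Real.rpow_natCast 2 i, ← Real.rpow_mul (by norm_num), mul_comm (i : ℝ),
              Real.rpow_mul (by norm_num) _ (i : ℝ), Real.rpow_natCast]
    refine Summable.of_norm_bounded_eventually_nat
      (g := fun i => t / (t - 1) * ((3 * (2 : ℝ) ^ ν) ^ θ * ((2 : ℝ) ^ (ν * θ - 1)) ^ i) +
          3 * (2 : ℝ) ^ ν * (D.card / (D.card - t)) * (1 / 2) ^ i) ?_ ?_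
    · refine Summable.add (((summable_geometric_of_lt_one (by positivity) ?_).mul_left _).mul_left _)
        ((summable_geometric_of_lt_one (by norm_num) (by norm_num)).mul_left _)
      exact Real.rpow_lt_one_of_one_lt_of_neg one_lt_two (by linarith)
    · filter_upwards [hb] with i hi
      rwa [Real.norm_of_nonneg (integral_nonneg fun α => levelEnergy_nonneg D (by linarith) _ _)]
  filter_upwards [ae_summable_of_summable_integral
    (fun i α => levelEnergy_nonneg D (by linarith) _ _)
    (fun i => integrable_levelEnergy_blockDensity_sub hD hD0 a ha (hSne i) (hS1 i) (J i) t)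
    hsummable] with α hα
  exact hα.tendsto_atTop_zero

/-! ### Refining and multiplying weights -/

lemma levelMass_congr {D : Finset ℕ} {L j u : ℕ} {w w' : ℕ → ℝ}
    (h : ∀ v ∈ triadic D L, v / 3 ^ (L - j) = u → w v = w' v) :
    levelMass D L j w u = levelMass D L j w' u :=
  Finset.sum_congr rfl fun v hv => h v (Finset.mem_filter.1 hv).1 (Finset.mem_filter.1 hv).2

lemma levelMass_self {D : Finset ℕ} {L u : ℕ} (hu : u ∈ triadic D L) (w : ℕ → ℝ) :
    levelMass D L L w u = w u := by
  simp [levelMass, Finset.filter_eq', hu]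

lemma levelMass_zero {D : Finset ℕ} (hD : ∀ d ∈ D, d < 3) (L : ℕ) (w : ℕ → ℝ) :
    levelMass D L 0 w 0 = ∑ v ∈ triadic D L, w v := by
  rw [levelMass, Finset.filter_true_of_mem]
  intro v hv
  exact Nat.div_eq_of_lt (lt_pow_of_mem_triadic hD hv)

lemma levelMass_levelMass {D : Finset ℕ} (hD : ∀ d ∈ D, d < 3) {j L R : ℕ} (hj : j ≤ L)
    (hL : L ≤ R) (w : ℕ → ℝ) (u : ℕ) :
    levelMass D L j (levelMass D R L w) u = levelMass D R j w u := by
  have hdiv : ∀ v : ℕ, v / 3 ^ (R - L) / 3 ^ (L - j) = v / 3 ^ (R - j) := fun v => by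
    rw [Nat.div_div_eq_div_mul, ← pow_add]
    congr 2; omega
  simp only [levelMass]
  rw [← Finset.sum_fiberwise_of_maps_to (s := (triadic D R).filter fun v => v / 3 ^ (R - j) = u)
    (t := (triadic D L).filter fun v => v / 3 ^ (L - j) = u) (g := fun v => v / 3 ^ (R - L))]
  · refine Finset.sum_congr rfl fun x hx => Finset.sum_congr ?_ fun _ _ => rfl
    ext v
    simp only [Finset.mem_filter] at hx ⊢
    constructor
    · rintro ⟨hv, rfl⟩
      exact ⟨⟨hv, by rw [← hdiv, hx.2]⟩, rfl⟩
    · rintro ⟨⟨hv, -⟩, h⟩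
      exact ⟨hv, h⟩
  · intro v hv
    simp only [Finset.mem_filter] at hv ⊢
    exact ⟨div_mem_triadic hD hL hv.1, by rw [hdiv, hv.2]⟩

lemma sum_triadic_div {D : Finset ℕ} (hD : ∀ d ∈ D, d < 3) {j J : ℕ} (hj : j ≤ J) (f : ℕ → ℝ) :
    ∑ v ∈ triadic D J, f (v / 3 ^ (J - j)) = (D.card : ℝ) ^ (J - j) * ∑ u ∈ triadic D j, f u := by
  rw [← Finset.sum_fiberwise_of_maps_to (t := triadic D j) (g := fun v => v / 3 ^ (J - j))
    fun v hv => div_mem_triadic hD hj hv, Finset.mul_sum]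
  refine Finset.sum_congr rfl fun u hu => ?_
  rw [Finset.sum_congr rfl fun v hv => by rw [(Finset.mem_filter.1 hv).2], Finset.sum_const,
    card_triadic_fiber hD hj hu, nsmul_eq_mul, Nat.cast_pow]

/-- The weight on level `R` obtained by distributing a weight on level `L ≤ R` uniformly. -/
noncomputable def extendWeight (D : Finset ℕ) (L R : ℕ) (w : ℕ → ℝ) (v : ℕ) : ℝ :=
  ((D.card : ℝ) ^ (R - L))⁻¹ * w (v / 3 ^ (R - L))

/-- The weight on level `J` with density `M` relative to a weight on level `L ≤ J`. -/
noncomputable def mulWeight (D : Finset ℕ) (L J : ℕ) (w M : ℕ → ℝ) (v : ℕ) : ℝ :=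
  (D.card : ℝ) ^ L * w (v / 3 ^ (J - L)) * M v

lemma levelMass_mulWeight {D : Finset ℕ} {L j J u : ℕ} (hL : L ≤ j)
    (hj : j ≤ J) (w M : ℕ → ℝ) :
    levelMass D J j (mulWeight D L J w M) u =
      (D.card : ℝ) ^ L * w (u / 3 ^ (j - L)) * levelMass D J j M u := by
  simp only [levelMass, Finset.mul_sum]
  refine Finset.sum_congr rfl fun v hv => ?_
  rw [mulWeight, ← (Finset.mem_filter.1 hv).2, Nat.div_div_eq_div_mul, ← pow_add]
  congr 5; omega

lemma levelMass_extendWeight_of_le {D : Finset ℕ} (hD : ∀ d ∈ D, d < 3) (hD0 : D.Nonempty)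
    {L j R u : ℕ} (hL : L ≤ j) (hj : j ≤ R) (hu : u ∈ triadic D j) (w : ℕ → ℝ) :
    levelMass D R j (extendWeight D L R w) u = extendWeight D L j w u := by
  have hq : (0 : ℝ) < D.card := by exact_mod_cast hD0.card_pos
  have h1 : ∀ v ∈ (triadic D R).filter fun v => v / 3 ^ (R - j) = u,
      extendWeight D L R w v = ((D.card : ℝ) ^ (R - L))⁻¹ * w (u / 3 ^ (j - L)) := by
    intro v hv
    rw [extendWeight, ← (Finset.mem_filter.1 hv).2, Nat.div_div_eq_div_mul, ← pow_add]
    congr 5; omega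
  rw [levelMass, Finset.sum_congr rfl h1, Finset.sum_const, card_triadic_fiber hD hj hu,
    nsmul_eq_mul, extendWeight, show R - L = (R - j) + (j - L) by omega, pow_add]
  push_cast
  field_simp

lemma levelMass_extendWeight {D : Finset ℕ} (hD : ∀ d ∈ D, d < 3) (hD0 : D.Nonempty)
    {j L R : ℕ} (hj : j ≤ L) (hL : L ≤ R) (w : ℕ → ℝ) (u : ℕ) :
    levelMass D R j (extendWeight D L R w) u = levelMass D L j w u := by
  rw [← levelMass_levelMass hD hj hL]
  refine levelMass_congr fun v hv _ => ?_
  rw [levelMass_extendWeight_of_le hD hD0 le_rfl hL hv]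
  simp [extendWeight]

lemma sum_sq_levelMass_le_energy {D : Finset ℕ} {t : ℝ} (ht : 0 ≤ t) {j L : ℕ} (hj : j ≤ L)
    (w : ℕ → ℝ) : t ^ j * ∑ u ∈ triadic D j, levelMass D L j w u ^ 2 ≤ levelEnergy D t L w :=
  Finset.single_le_sum
    (f := fun j => t ^ j * ∑ u ∈ triadic D j, levelMass D L j w u ^ 2)
    (fun _ _ => mul_nonneg (pow_nonneg ht _) (Finset.sum_nonneg fun _ _ => sq_nonneg _))
    (Finset.mem_range.2 (Nat.lt_succ_of_le hj))

/-- Uniform refinement keeps all masses up to level `L`; below it each further level multiplies the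
energy term by `t / D.card < 1`, so the bound does not depend on `R`. -/
lemma levelEnergy_extendWeight_le {D : Finset ℕ} (hD : ∀ d ∈ D, d < 3) {t : ℝ} (ht : 0 ≤ t)
    (htq : t < D.card) {L R : ℕ} (hL : L ≤ R) (w : ℕ → ℝ) :
    levelEnergy D t R (extendWeight D L R w) ≤
      (1 + D.card / (D.card - t)) * levelEnergy D t L w := by
  have hq : (0 : ℝ) < D.card := ht.trans_lt htq
  have hD0 : D.Nonempty := by rw [← Finset.card_pos]; exact_mod_cast hq
  obtain ⟨i, rfl⟩ := Nat.exists_eq_add_of_le hL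
  rw [levelEnergy, show L + i + 1 = (L + 1) + i by omega, Finset.sum_range_add, add_mul, one_mul]
  refine add_le_add (le_of_eq ?_) ?_
  · refine Finset.sum_congr rfl fun j hj => ?_
    congr 1
    refine Finset.sum_congr rfl fun u hu => ?_
    rw [levelMass_extendWeight hD hD0 (Nat.lt_succ_iff.1 (Finset.mem_range.1 hj)) hL]
  · have hterm : ∀ k ∈ Finset.range i, t ^ (L + 1 + k) * ∑ u ∈ triadic D (L + 1 + k),
        levelMass D (L + i) (L + 1 + k) (extendWeight D L (L + i) w) u ^ 2 ≤
        (t / D.card) ^ k * levelEnergy D t L w := by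
      intro k hk
      have hk' := Finset.mem_range.1 hk
      have h1 : ∑ u ∈ triadic D (L + 1 + k),
          levelMass D (L + i) (L + 1 + k) (extendWeight D L (L + i) w) u ^ 2 =
          ((D.card : ℝ) ^ (k + 1))⁻¹ * ∑ u ∈ triadic D L, w u ^ 2 := by
        rw [Finset.sum_congr rfl fun u hu => by
          rw [levelMass_extendWeight_of_le hD hD0 (by omega) (by omega) hu]]
        simp only [extendWeight, mul_pow]
        rw [← Finset.mul_sum, sum_triadic_div hD (by omega) (fun u => w u ^ 2),
          show L + 1 + k - L = k + 1 by omega]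
        field_simp
      have h2 : t ^ L * ∑ u ∈ triadic D L, w u ^ 2 ≤ levelEnergy D t L w := by
        refine le_trans (le_of_eq ?_) (sum_sq_levelMass_le_energy ht le_rfl w)
        rw [Finset.sum_congr rfl fun u hu => by rw [← levelMass_self hu w]]
      have h3 : t / D.card ≤ 1 := (div_le_one hq).2 htq.le
      have h4 : 0 ≤ levelEnergy D t L w := levelEnergy_nonneg D ht L w
      calc _ = (t / D.card) ^ k * ((t / D.card) * (t ^ L * ∑ u ∈ triadic D L, w u ^ 2)) := by
            rw [h1, div_pow, pow_add, pow_add, pow_succ]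
            field_simp
            ring
        _ ≤ (t / D.card) ^ k * (1 * levelEnergy D t L w) := by gcongr
        _ = _ := by rw [one_mul]
    refine (Finset.sum_le_sum hterm).trans ?_
    rw [← Finset.sum_mul]
    refine mul_le_mul_of_nonneg_right ?_ (levelEnergy_nonneg D ht L w)
    have h1 : t / D.card < 1 := (div_lt_one hq).2 htq
    have h0 : 0 ≤ t / D.card := by positivity
    refine (Summable.sum_le_tsum _ (fun i _ => pow_nonneg h0 i)
      (summable_geometric_of_lt_one h0 h1)).trans (le_of_eq ?_)
    rw [tsum_geometric_of_lt_one h0 h1, one_sub_div hq.ne', inv_div]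

/-- From level `L` on, the factor coming from `w` is constant on each interval and bounded by `W`.
Coarser levels are controlled by level `L` through Cauchy–Schwarz. The constant is crude but
independent of `J`, which is what matters when `L` and `w` are fixed and the energy of `δ` tends to
`0`. -/
lemma levelEnergy_mulWeight_le {D : Finset ℕ} (hD : ∀ d ∈ D, d < 3) (hD0 : D.Nonempty) {t : ℝ}
    (ht : 1 ≤ t) {L J : ℕ} (hL : L ≤ J) {w : ℕ → ℝ} {W : ℝ}
    (hW : ∀ v ∈ triadic D L, |(D.card : ℝ) ^ L * w v| ≤ W) (δ : ℕ → ℝ) :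
    levelEnergy D t J (mulWeight D L J w δ) ≤
      ((L * (D.card : ℝ) ^ L + 1) * W ^ 2) * levelEnergy D t J δ := by
  have ht0 : 0 ≤ t := zero_le_one.trans ht
  have hq : (1 : ℝ) ≤ D.card := by exact_mod_cast hD0.card_pos
  set E := levelEnergy D t J δ with hE
  have hE0 : 0 ≤ E := levelEnergy_nonneg D ht0 J δ
  have hhigh : ∀ j, L ≤ j → j ≤ J → ∑ u ∈ triadic D j, levelMass D J j (mulWeight D L J w δ) u ^ 2
      ≤ W ^ 2 * ∑ u ∈ triadic D j, levelMass D J j δ u ^ 2 := by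
    intro j hLj hj
    rw [Finset.mul_sum]
    refine Finset.sum_le_sum fun u hu => ?_
    rw [levelMass_mulWeight hLj hj, mul_pow]
    refine mul_le_mul_of_nonneg_right ?_ (sq_nonneg _)
    rw [← sq_abs]
    exact pow_le_pow_left₀ (abs_nonneg _) (hW _ (div_mem_triadic hD hLj hu)) 2
  have hterm : ∀ j ∈ Finset.range (J + 1), t ^ j * ∑ u ∈ triadic D j,
      levelMass D J j (mulWeight D L J w δ) u ^ 2 ≤
      (if j < L then (D.card : ℝ) ^ L * W ^ 2 * E else 0) +
        W ^ 2 * (t ^ j * ∑ u ∈ triadic D j, levelMass D J j δ u ^ 2) := by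
    intro j hj
    have hj := Nat.lt_succ_iff.1 (Finset.mem_range.1 hj)
    split_ifs with h
    · refine le_trans ?_ (le_add_of_nonneg_right (by positivity))
      set y := levelMass D J L (mulWeight D L J w δ) with hy
      have h1 : ∑ u ∈ triadic D j, levelMass D J j (mulWeight D L J w δ) u ^ 2 ≤
          (D.card : ℝ) ^ L * ∑ v ∈ triadic D L, y v ^ 2 := by
        rw [← Finset.sum_fiberwise_of_maps_to (s := triadic D L) (t := triadic D j)
          (g := fun v => v / 3 ^ (L - j)) fun v hv => div_mem_triadic hD h.le hv, Finset.mul_sum]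
        refine Finset.sum_le_sum fun u hu => ?_
        rw [← levelMass_levelMass hD h.le hL, ← hy, levelMass]
        refine sq_sum_le_card_mul_sum_sq.trans ?_
        rw [card_triadic_fiber hD h.le hu, Nat.cast_pow]
        gcongr
        exact Nat.sub_le _ _
      calc _ ≤ t ^ L * ((D.card : ℝ) ^ L * (W ^ 2 * ∑ v ∈ triadic D L, levelMass D J L δ v ^ 2)) := by
            gcongr ?_ * ?_
            · exact pow_le_pow_right₀ ht h.le
            · exact h1.trans (by gcongr; exact hhigh L le_rfl hL)
        _ = (D.card : ℝ) ^ L * W ^ 2 * (t ^ L * ∑ v ∈ triadic D L, levelMass D J L δ v ^ 2) := by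
            ring
        _ ≤ _ := by
            gcongr
            exact sum_sq_levelMass_le_energy ht0 hL δ
    · rw [zero_add, mul_left_comm]
      gcongr
      exact hhigh j (not_lt.1 h) hj
  refine (Finset.sum_le_sum hterm).trans ?_
  rw [Finset.sum_add_distrib, ← Finset.mul_sum, ← levelEnergy, ← hE, ← Finset.sum_filter,
    Finset.sum_const, nsmul_eq_mul]
  have : (((Finset.range (J + 1)).filter (· < L)).card : ℝ) ≤ L := by
    have := Finset.card_le_card (show (Finset.range (J + 1)).filter (· < L) ⊆ Finset.range L from
      fun x hx => Finset.mem_range.2 (Finset.mem_filter.1 hx).2)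
    rw [Finset.card_range] at this
    exact_mod_cast this
  calc _ ≤ L * ((D.card : ℝ) ^ L * W ^ 2 * E) + W ^ 2 * E := by gcongr
    _ = _ := by ring

lemma levelMass_add (D : Finset ℕ) (L j : ℕ) (x y : ℕ → ℝ) (u : ℕ) :
    levelMass D L j (x + y) u = levelMass D L j x u + levelMass D L j y u :=
  Finset.sum_add_distrib

lemma levelEnergy_add_le (D : Finset ℕ) {t : ℝ} (ht : 0 ≤ t) (L : ℕ) (x y : ℕ → ℝ) {η : ℝ}
    (hη : 0 < η) : levelEnergy D t L (x + y) ≤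
      (1 + η) * levelEnergy D t L x + (1 + 1 / η) * levelEnergy D t L y := by
  simp only [levelEnergy, Finset.mul_sum]
  rw [← Finset.sum_add_distrib]
  refine Finset.sum_le_sum fun j _ => ?_
  rw [← Finset.sum_add_distrib]
  refine Finset.sum_le_sum fun u _ => ?_
  rw [levelMass_add]
  set a := levelMass D L j x u
  set b := levelMass D L j y u
  have h : (a + b) ^ 2 ≤ (1 + η) * a ^ 2 + (1 + 1 / η) * b ^ 2 := by
    have : 0 ≤ (η * a - b) ^ 2 / η := by positivity
    have h2 : (η * a - b) ^ 2 / η = η * a ^ 2 - 2 * a * b + 1 / η * b ^ 2 := by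
      field_simp
      ring
    rw [h2] at this
    nlinarith
  calc _ ≤ t ^ j * ((1 + η) * a ^ 2 + (1 + 1 / η) * b ^ 2) := by gcongr
    _ = _ := by ring

/-! ### Nested weights of bounded energy -/

/-- A nonnegative weight on level `L` with mass more than `1 / 2` whose energy is smaller than `β`. -/
structure IsGoodWeight (D : Finset ℕ) (t β : ℝ) (L : ℕ) (w : ℕ → ℝ) : Prop where
  nonneg : ∀ v, 0 ≤ w v
  mass : 1 / 2 < ∑ v ∈ triadic D L, w v
  -- A bound `b` uniform in `R` and strictly below `β` leaves room for a perturbation at an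
  -- arbitrarily deep level.
  energy : ∃ b < β, ∀ R ≥ L, levelEnergy D t R (extendWeight D L R w) ≤ b

lemma extendWeight_extendWeight {D : Finset ℕ} {L J R : ℕ} (hL : L ≤ J) (hJ : J ≤ R) (w : ℕ → ℝ) :
    extendWeight D J R (extendWeight D L J w) = extendWeight D L R w := by
  ext v
  simp only [extendWeight]
  rw [Nat.div_div_eq_div_mul, ← pow_add, ← mul_assoc, ← mul_inv, ← pow_add,
    show R - J + (J - L) = R - L by omega]

lemma IsGoodWeight.energy_le {D : Finset ℕ} {t β : ℝ} {L : ℕ} {w : ℕ → ℝ}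
    (h : IsGoodWeight D t β L w) : levelEnergy D t L w ≤ β := by
  obtain ⟨b, hb, hE⟩ := h.energy
  have := hE L le_rfl
  have he : extendWeight D L L w = w := by ext v; simp [extendWeight]
  rw [he] at this
  exact this.trans hb.le

lemma isGoodWeight_one {D : Finset ℕ} (hD : ∀ d ∈ D, d < 3) {t : ℝ} (ht : 0 ≤ t)
    (htq : t < D.card) : IsGoodWeight D t (2 + D.card / (D.card - t)) 0 1 where
  nonneg _ := zero_le_one
  mass := by norm_num [triadic]
  energy := by
    refine ⟨1 + D.card / (D.card - t), by linarith, fun R _ => ?_⟩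
    refine (levelEnergy_extendWeight_le hD ht htq (Nat.zero_le R) 1).trans (le_of_eq ?_)
    simp [levelEnergy, levelMass, triadic, Finset.filter_true_of_mem]

/-- With `δ` the deviation of `M i` from uniform, the product weight is the uniform refinement of
`w` plus `mulWeight` of `w` and `δ`. The latter has energy tending to `0`, and the strict
inequalities for mass and energy survive a small perturbation. -/
lemma IsGoodWeight.eventually_mulWeight {D : Finset ℕ} (hD : ∀ d ∈ D, d < 3) {t β : ℝ}
    (ht : 1 ≤ t) (htq : t < D.card) {L : ℕ} {w : ℕ → ℝ} (h : IsGoodWeight D t β L w)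
    {J : ℕ → ℕ} (hJ : Tendsto J atTop atTop) {M : ℕ → ℕ → ℝ} (hM : ∀ i v, 0 ≤ M i v)
    (hlim : Tendsto (fun i => levelEnergy D t (J i)
      fun v => M i v - ((D.card : ℝ) ^ J i)⁻¹) atTop (nhds 0)) :
    ∀ᶠ i in atTop, L ≤ J i ∧ IsGoodWeight D t β (J i) (mulWeight D L (J i) w (M i)) := by
  have ht0 : 0 ≤ t := zero_le_one.trans ht
  have hq : (0 : ℝ) < D.card := ht0.trans_lt htq
  have hD0 : D.Nonempty := by rw [← Finset.card_pos]; exact_mod_cast hq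
  obtain ⟨b, hb, hE⟩ := h.energy
  obtain ⟨W, hW⟩ : ∃ W, ∀ v ∈ triadic D L, |(D.card : ℝ) ^ L * w v| ≤ W :=
    ⟨_, fun v hv => Finset.single_le_sum (f := fun v => |(D.card : ℝ) ^ L * w v|)
      (fun _ _ => abs_nonneg _) hv⟩
  set C : ℝ := (L * (D.card : ℝ) ^ L + 1) * W ^ 2 with hC
  set δ : ℕ → ℕ → ℝ := fun i v => M i v - ((D.card : ℝ) ^ J i)⁻¹ with hδ
  have hb0 : 0 ≤ b := (levelEnergy_nonneg D ht0 _ _).trans (hE L le_rfl)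
  obtain ⟨η, hη, hηb⟩ : ∃ η > 0, (1 + η) * b < β := by
    have : Tendsto (fun η : ℝ => (1 + η) * b) (nhdsWithin 0 (Set.Ioi 0)) (nhds ((1 + 0) * b)) :=
      (Continuous.tendsto (by fun_prop) 0).mono_left nhdsWithin_le_nhds
    have h2 := (this.eventually_lt_const (by linarith : (1 + 0) * b < β)).and self_mem_nhdsWithin
    obtain ⟨η, h3, h4⟩ := h2.exists
    exact ⟨η, h4, h3⟩
  set A : ℝ := 1 + D.card / (D.card - t) with hA
  have hA0 : 0 ≤ A := by
    have : 0 < D.card - t := by linarith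
    positivity
  have hlim1 : Tendsto (fun i => (1 + η) * b + (1 + 1 / η) * (A * (C * levelEnergy D t (J i) (δ i))))
      atTop (nhds ((1 + η) * b + (1 + 1 / η) * (A * (C * 0)))) :=
    ((((hlim.const_mul C).const_mul A).const_mul _).const_add _)
  have hlim2 : Tendsto (fun i => C * levelEnergy D t (J i) (δ i)) atTop (nhds (C * 0)) :=
    hlim.const_mul C
  rw [mul_zero, mul_zero, mul_zero, add_zero] at hlim1
  rw [mul_zero] at hlim2
  have hm : 0 < ∑ v ∈ triadic D L, w v - 1 / 2 := by linarith [h.mass]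
  filter_upwards [hJ.eventually_ge_atTop L, hlim1.eventually_lt_const hηb,
    hlim2.eventually_lt_const (pow_pos hm 2)] with i hLi h1 h2
  have hsplit : mulWeight D L (J i) w (M i) =
      extendWeight D L (J i) w + mulWeight D L (J i) w (δ i) := by
    ext v
    simp only [mulWeight, extendWeight, hδ, Pi.add_apply]
    have : (D.card : ℝ) ^ J i = D.card ^ L * D.card ^ (J i - L) := by
      rw [← pow_add]; congr 1; omega
    rw [this]
    field_simp
    ring
  have hEδ : levelEnergy D t (J i) (mulWeight D L (J i) w (δ i)) ≤
      C * levelEnergy D t (J i) (δ i) := levelEnergy_mulWeight_le hD hD0 ht hLi hW (δ i)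
  refine ⟨hLi, fun v => mul_nonneg (mul_nonneg (by positivity) (h.nonneg _)) (hM _ _), ?_, _, h1,
    fun R hR => ?_⟩
  -- The level `0` term of the energy is the square of the total mass, so small energy also means
  -- small change of mass.
  · have h3 : (levelMass D (J i) 0 (mulWeight D L (J i) w (δ i)) 0) ^ 2 ≤
        levelEnergy D t (J i) (mulWeight D L (J i) w (δ i)) := by
      refine le_trans (le_of_eq ?_) (sum_sq_levelMass_le_energy ht0 (Nat.zero_le (J i)) _)
      simp [triadic]
    have h4 := abs_lt_of_sq_lt_sq ((h3.trans hEδ).trans_lt h2) hm.le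
    rw [← levelMass_zero hD, hsplit, levelMass_add, levelMass_extendWeight hD hD0 (Nat.zero_le _) hLi,
      levelMass_zero hD L]
    linarith [(abs_lt.1 h4).1]
  · have : extendWeight D (J i) R (mulWeight D L (J i) w (M i)) =
        extendWeight D L R w + extendWeight D (J i) R (mulWeight D L (J i) w (δ i)) := by
      rw [hsplit, ← extendWeight_extendWeight hLi hR]
      ext v
      simp only [extendWeight, Pi.add_apply, mul_add]
    rw [this]
    refine (levelEnergy_add_le D ht0 R _ _ hη).trans ?_
    gcongr
    · exact hE R (hLi.trans hR)
    · exact (levelEnergy_extendWeight_le hD ht0 htq hR _).trans (by gcongr)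

/-- The union of the level `L` intervals charged by the weight `w`. -/
def weightSupport (D : Finset ℕ) (L : ℕ) (w : ℕ → ℝ) : Set ℝ :=
  ⋃ v ∈ (triadic D L).filter fun v => w v ≠ 0, triadicIcc L v

lemma mem_weightSupport {D : Finset ℕ} {L : ℕ} {w : ℕ → ℝ} {x : ℝ} :
    x ∈ weightSupport D L w ↔ ∃ v ∈ triadic D L, w v ≠ 0 ∧ x ∈ triadicIcc L v := by
  simp [weightSupport, and_assoc]

lemma isCompact_weightSupport (D : Finset ℕ) (L : ℕ) (w : ℕ → ℝ) :
    IsCompact (weightSupport D L w) :=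
  Finset.isCompact_biUnion _ fun _ _ => isCompact_triadicIcc _ _

lemma weightSupport_mulWeight_subset {D : Finset ℕ} (hD : ∀ d ∈ D, d < 3) {L J : ℕ} (hL : L ≤ J)
    (w M : ℕ → ℝ) : weightSupport D J (mulWeight D L J w M) ⊆ weightSupport D L w := by
  intro x hx
  obtain ⟨v, hv, h0, hx⟩ := mem_weightSupport.1 hx
  refine mem_weightSupport.2 ⟨v / 3 ^ (J - L), div_mem_triadic hD hL hv, fun h => h0 ?_,
    triadicIcc_subset_div hL v hx⟩
  simp [mulWeight, h]

lemma exists_seq_isGoodWeight {D : Finset ℕ} (hD : ∀ d ∈ D, d < 3) {t : ℝ}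
    (ht : 1 ≤ t) (htq : t < D.card) {J : ℕ → ℕ} (hJ : Tendsto J atTop atTop)
    {M : ℕ → ℕ → ℝ} (hM : ∀ i v, 0 ≤ M i v)
    (hlim : Tendsto (fun i => levelEnergy D t (J i)
      fun v => M i v - ((D.card : ℝ) ^ J i)⁻¹) atTop (nhds 0)) :
    ∃ β : ℝ, ∃ i : ℕ → ℕ, StrictMono i ∧ ∃ w : ℕ → ℕ → ℝ,
      (∀ k, IsGoodWeight D t β (J (i k)) (w k)) ∧
      (∀ k, ∀ v, w k v ≠ 0 → M (i k) v ≠ 0) ∧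
      Antitone fun k => weightSupport D (J (i k)) (w k) := by
  have ht0 : 0 ≤ t := zero_le_one.trans ht
  set β : ℝ := 2 + D.card / (D.card - t) with hβ
  have hstep : ∀ p : {p : ℕ × ℕ × (ℕ → ℝ) // IsGoodWeight D t β p.2.1 p.2.2},
      ∃ q : {p : ℕ × ℕ × (ℕ → ℝ) // IsGoodWeight D t β p.2.1 p.2.2},
        p.1.1 < q.1.1 ∧ q.1.2.1 = J q.1.1 ∧ p.1.2.1 ≤ q.1.2.1 ∧
        q.1.2.2 = mulWeight D p.1.2.1 q.1.2.1 p.1.2.2 (M q.1.1) := by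
    rintro ⟨⟨i, L, w⟩, h⟩
    obtain ⟨i', h1, h2⟩ := ((h.eventually_mulWeight hD ht htq hJ hM hlim).and
      (eventually_gt_atTop i)).exists
    exact ⟨⟨⟨i', J i', mulWeight D L (J i') w (M i')⟩, h1.2⟩, h2, rfl, h1.1, rfl⟩
  choose step h1 h2 h3 h4 using hstep
  -- The sequence starts one step after the trivial weight, whose level `0` need not be a value of
  -- `J`; thus every term is an output of `step`.
  let s : ℕ → {p : ℕ × ℕ × (ℕ → ℝ) // IsGoodWeight D t β p.2.1 p.2.2} := fun k =>
    Nat.rec (step ⟨⟨0, 0, 1⟩, isGoodWeight_one hD ht0 htq⟩) (fun _ p => step p) k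
  have hs : ∀ k, s (k + 1) = step (s k) := fun _ => rfl
  have hsJ : ∀ k, (s k).1.2.1 = J (s k).1.1 := by
    intro k
    cases k with
    | zero => exact h2 _
    | succ k => rw [hs]; exact h2 _
  refine ⟨β, fun k => (s k).1.1, strictMono_nat_of_lt_succ fun k => h1 _, fun k => (s k).1.2.2,
    fun k => ?_, fun k v hv hM0 => hv ?_, antitone_nat_of_succ_le fun k => ?_⟩
  · have := (s k).2
    rwa [hsJ] at this
  · have : ∃ p, s k = step p := by
      cases k with
      | zero => exact ⟨_, rfl⟩
      | succ k => exact ⟨_, hs k⟩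
    obtain ⟨p, hp⟩ := this
    simp only [hp] at hM0 ⊢
    rw [h4, mulWeight, hM0, mul_zero]
  · simp only [← hsJ]
    rw [hs, h4]
    exact weightSupport_mulWeight_subset hD (h3 _) _ _

/-! ### From bounded energy to positive Hausdorff measure -/

/-- The level `j` intervals of `triadic D j` whose index is close to `3 ^ j * y`. -/
noncomputable def nearIndices (D : Finset ℕ) (j : ℕ) (y : ℝ) : Finset ℕ :=
  (triadic D j).filter fun u : ℕ => |(u : ℝ) - 3 ^ j * y| ≤ 3

lemma card_nearIndices_le (D : Finset ℕ) (j : ℕ) (y : ℝ) : (nearIndices D j y).card ≤ 7 := by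
  have hsub : (nearIndices D j y).image (fun u : ℕ => (u : ℤ)) ⊆
      Finset.Icc ⌈3 ^ j * y - 3⌉ (⌈3 ^ j * y - 3⌉ + 6) := by
    intro z hz
    obtain ⟨u, hu, rfl⟩ := Finset.mem_image.1 hz
    have h := abs_le.1 (Finset.mem_filter.1 hu).2
    rw [Finset.mem_Icc]
    constructor
    · rw [Int.ceil_le]; push_cast; linarith
    · have := Int.le_ceil (3 ^ j * y - 3)
      have h2 : ((u : ℤ) : ℝ) ≤ ((⌈3 ^ j * y - 3⌉ + 6 : ℤ) : ℝ) := by push_cast; linarith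
      exact_mod_cast h2
  have := Finset.card_le_card hsub
  rw [Finset.card_image_of_injective _ Nat.cast_injective, Int.card_Icc] at this
  omega

lemma mem_nearIndices {D : Finset ℕ} {j u : ℕ} (hu : u ∈ triadic D j) {x y : ℝ}
    (hx : x ∈ triadicIcc j u) (hxy : |x - y| ≤ 2 * (1 / 3) ^ j) : u ∈ nearIndices D j y := by
  have hp : (0 : ℝ) < 3 ^ j := by positivity
  refine Finset.mem_filter.2 ⟨hu, ?_⟩
  have h1 := hx.1; have h2 := hx.2
  rw [div_le_iff₀ hp] at h1
  rw [le_div_iff₀ hp] at h2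
  rw [one_div_pow, mul_one_div, le_div_iff₀ hp] at hxy
  have h3 := abs_le.1 (show |(x - y) * 3 ^ j| ≤ 2 by rwa [abs_mul, abs_of_pos hp])
  rw [abs_le]
  constructor <;> nlinarith

lemma sum_biUnion_le_sum {ι κ : Type*} [DecidableEq κ] (I : Finset ι) (B : ι → Finset κ)
    {f : κ → ℝ} (hf : ∀ x, 0 ≤ f x) : ∑ x ∈ I.biUnion B, f x ≤ ∑ i ∈ I, ∑ x ∈ B i, f x := by
  classical
  induction I using Finset.induction_on with
  | empty => simp
  | insert i I hi ih =>
    rw [Finset.biUnion_insert, Finset.sum_insert hi]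
    have := Finset.sum_union_inter (s₁ := B i) (s₂ := I.biUnion B) (f := f)
    have h2 : 0 ≤ ∑ x ∈ B i ∩ I.biUnion B, f x := Finset.sum_nonneg fun x _ => hf x
    linarith

/-- Each covering piece meets at most `7` triadic intervals of its own level. The chosen intervals
carry mass more than `1 / 2`, and Cauchy–Schwarz bounds its square by the sum of `t ^ (-j)` times
the energy. -/
lemma sum_sq_le_of_cover {D : Finset ℕ} (hD : ∀ d ∈ D, d < 3) {t β : ℝ} (ht : 0 < t) {L : ℕ}
    {w : ℕ → ℝ} (hw : IsGoodWeight D t β L w) {I : Finset ℕ} {j : ℕ → ℕ} (hj : ∀ n ∈ I, j n ≤ L)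
    {y : ℕ → ℝ} (hcov : ∀ x ∈ weightSupport D L w, ∃ n ∈ I, |x - y n| ≤ 2 * (1 / 3) ^ j n) :
    1 / 4 < (7 * ∑ n ∈ I, (t ^ j n)⁻¹) * β := by
  classical
  -- Taking pairs (level, index) as a set counts each interval once, so the energy restricted to `Q`
  -- is a partial sum of `levelEnergy`.
  let Q : Finset (Σ _ : ℕ, ℕ) := I.biUnion fun n =>
    (nearIndices D (j n) (y n)).map (Function.Embedding.sigmaMk (β := fun _ : ℕ => ℕ) (j n))
  have hQ : Q ⊆ (Finset.range (L + 1)).sigma fun j => triadic D j := by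
    intro p hp
    simp only [Q, Finset.mem_biUnion, Finset.mem_map] at hp
    obtain ⟨n, hn, u, hu, rfl⟩ := hp
    exact Finset.mem_sigma.2 ⟨Finset.mem_range.2 (Nat.lt_succ_of_le (hj n hn)),
      (Finset.mem_filter.1 hu).1⟩
  have hmass : ∑ v ∈ triadic D L, w v ≤ ∑ p ∈ Q, levelMass D L p.1 w p.2 := by
    simp only [levelMass, Finset.sum_filter]
    rw [Finset.sum_comm]
    refine Finset.sum_le_sum fun v hv => ?_
    by_cases h0 : w v = 0
    · simp [h0]
    · obtain ⟨x, hx⟩ := triadicIcc_nonempty L v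
      obtain ⟨n, hn, hxn⟩ := hcov x (mem_weightSupport.2 ⟨v, hv, h0, hx⟩)
      have hmem : (⟨j n, v / 3 ^ (L - j n)⟩ : Σ _ : ℕ, ℕ) ∈ Q :=
        Finset.mem_biUnion.2 ⟨n, hn, Finset.mem_map.2 ⟨_, mem_nearIndices
          (div_mem_triadic hD (hj n hn) hv) (triadicIcc_subset_div (hj n hn) v hx) hxn, rfl⟩⟩
      have := Finset.single_le_sum (f := fun p : Σ _ : ℕ, ℕ =>
        if v / 3 ^ (L - p.1) = p.2 then w v else 0)
        (fun p _ => by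
          have := hw.nonneg v
          positivity) hmem
      simpa using this
  have hweights : ∑ p ∈ Q, (t ^ p.1)⁻¹ ≤ 7 * ∑ n ∈ I, (t ^ j n)⁻¹ := by
    refine (sum_biUnion_le_sum I _ fun _ => by positivity).trans ?_
    rw [Finset.mul_sum]
    refine Finset.sum_le_sum fun n _ => ?_
    rw [Finset.sum_map]
    simp only [Function.Embedding.sigmaMk_apply, Finset.sum_const, nsmul_eq_mul]
    gcongr
    exact_mod_cast card_nearIndices_le _ _ _
  have henergy : ∑ p ∈ Q, t ^ p.1 * levelMass D L p.1 w p.2 ^ 2 ≤ β := by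
    refine (Finset.sum_le_sum_of_subset_of_nonneg hQ fun p _ _ => by positivity).trans ?_
    rw [Finset.sum_sigma]
    refine le_trans (le_of_eq ?_) hw.energy_le
    simp only [levelEnergy, Finset.mul_sum]
  have hcs := Finset.sum_sq_le_sum_mul_sum_of_sq_le_mul Q
    (r := fun p => levelMass D L p.1 w p.2) (f := fun p => (t ^ p.1)⁻¹)
    (g := fun p => t ^ p.1 * levelMass D L p.1 w p.2 ^ 2) (fun p _ => by positivity)
    (fun p _ => by positivity) (fun p _ => by field_simp; rfl)
  have h12 := hw.mass.trans_le hmass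
  calc (1 / 4 : ℝ) < (∑ p ∈ Q, levelMass D L p.1 w p.2) ^ 2 := by nlinarith
    _ ≤ _ := hcs
    _ ≤ _ := by
      refine mul_le_mul hweights henergy (Finset.sum_nonneg fun p _ => by positivity) ?_
      exact mul_nonneg (by norm_num) (Finset.sum_nonneg fun p _ => by positivity)

open ENNReal in
-- A null cover is normalised to triadic sizes. Pieces of diameter `0` have no triadic size, so each
-- `d n ^ s` is first padded by a term of a small geometric series.
lemma exists_cover_of_hausdorffMeasure_eq_zero {E : Set ℝ} {s : ℝ} (hs : 0 < s)
    (hE : Measure.hausdorffMeasure s E = 0) {δ : ℝ} (hδ : 0 < δ) :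
    ∃ (U : ℕ → Set ℝ) (j : ℕ → ℕ), E ⊆ ⋃ n, U n ∧
      (∀ n, ∀ x ∈ U n, ∀ y ∈ U n, |x - y| ≤ (1 / 3) ^ j n) ∧
      (∀ I : Finset ℕ, ∑ n ∈ I, (((3 : ℝ) ^ s) ^ j n)⁻¹ ≤ δ) := by
  -- The `1 / 2` keeps padded sizes at most `1`; the `2` pays for the padding and `3 ^ s` for
  -- rounding to a power of `1 / 3`.
  set δ' : ℝ := min (1 / 2) (δ / (2 * 3 ^ s)) with hδ'
  have hδ0 : 0 < δ' := by positivity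
  rw [Measure.hausdorffMeasure_apply] at hE
  have h1 := (iSup_le_iff.1 (iSup_le_iff.1 hE.le 1) one_pos)
  have h2 := lt_of_le_of_lt h1 (ENNReal.ofReal_pos.2 hδ0)
  simp only [iInf_lt_iff] at h2
  obtain ⟨U, hU, hdiam, hsum⟩ := h2
  have hterm : ∀ n, (⨆ _ : (U n).Nonempty, Metric.ediam (U n) ^ s) = Metric.ediam (U n) ^ s := by
    intro n
    rcases (U n).eq_empty_or_nonempty with h | h
    · simp [h, hs]
    · simp [h]
  simp only [hterm] at hsum
  have hfin : ∀ n, Metric.ediam (U n) ≠ ∞ := fun n => ((hdiam n).trans_lt one_lt_top).ne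
  set d : ℕ → ℝ := fun n => (Metric.ediam (U n)).toReal with hd
  have hdof : ∀ n, Metric.ediam (U n) ^ s = ENNReal.ofReal (d n ^ s) := fun n => by
    rw [← ENNReal.ofReal_rpow_of_nonneg toReal_nonneg hs.le, ENNReal.ofReal_toReal (hfin n)]
  have hdsum : ∀ I : Finset ℕ, ∑ n ∈ I, d n ^ s ≤ δ' := by
    intro I
    have := (ENNReal.sum_le_tsum I).trans hsum.le
    simp only [hdof] at this
    rwa [← ENNReal.ofReal_sum_of_nonneg fun n _ => Real.rpow_nonneg toReal_nonneg _,
      ENNReal.ofReal_le_ofReal_iff hδ0.le] at this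
  set e : ℕ → ℝ := fun n => d n ^ s + δ' * (1 / 2) ^ (n + 1) with he
  have he0 : ∀ n, 0 < e n := fun n =>
    add_pos_of_nonneg_of_pos (Real.rpow_nonneg toReal_nonneg _) (by positivity)
  have hesum : ∀ I : Finset ℕ, ∑ n ∈ I, e n ≤ 2 * δ' := by
    intro I
    rw [he, Finset.sum_add_distrib, ← Finset.mul_sum]
    have h3 : ∑ n ∈ I, (1 / 2 : ℝ) ^ (n + 1) ≤ 1 := by
      have hsm : Summable fun n : ℕ => (1 / 2 : ℝ) ^ (n + 1) :=
        (summable_nat_add_iff 1).2 summable_geometric_two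
      refine (hsm.sum_le_tsum I fun _ _ => by positivity).trans (le_of_eq ?_)
      simp only [pow_succ]
      rw [tsum_mul_right, tsum_geometric_two]
      norm_num
    nlinarith [hdsum I]
  have hx : ∀ n, ∃ m : ℕ, (1 / 3 : ℝ) ^ (m + 1) < e n ^ (1 / s) ∧ e n ^ (1 / s) ≤ (1 / 3) ^ m := by
    intro n
    refine exists_nat_pow_near_of_lt_one (Real.rpow_pos_of_pos (he0 n) _)
      (Real.rpow_le_one (he0 n).le ?_ (by positivity)) (by norm_num) (by norm_num)
    have := hesum {n}
    rw [Finset.sum_singleton] at this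
    linarith [min_le_left (1 / 2) (δ / (2 * 3 ^ s))]
  choose j hj1 hj2 using hx
  refine ⟨U, j, hU, fun n x hx y hy => ?_, fun I => ?_⟩
  · have hde : d n ≤ e n ^ (1 / s) := by
      have : d n = (d n ^ s) ^ (1 / s) := by
        rw [← Real.rpow_mul toReal_nonneg, mul_one_div_cancel hs.ne', Real.rpow_one]
      rw [this]
      refine Real.rpow_le_rpow (Real.rpow_nonneg toReal_nonneg _) ?_ (by positivity)
      exact le_add_of_nonneg_right (by positivity)
    refine le_trans ?_ (hde.trans (hj2 n))
    rw [← Real.dist_eq, hd]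
    have := ENNReal.toReal_mono (hfin n) (Metric.edist_le_ediam_of_mem hx hy)
    rwa [edist_dist, ENNReal.toReal_ofReal dist_nonneg] at this
  · have hbound : ∀ n, (((3 : ℝ) ^ s) ^ j n)⁻¹ ≤ 3 ^ s * e n := by
      intro n
      have h4 := Real.rpow_le_rpow (by positivity) (hj1 n).le hs.le
      rw [← Real.rpow_mul (he0 n).le, one_div_mul_cancel hs.ne', Real.rpow_one,
        ← Real.rpow_natCast, ← Real.rpow_mul (by norm_num), mul_comm, Real.rpow_mul (by norm_num),
        Real.rpow_natCast, pow_succ, Real.div_rpow (by norm_num) (by norm_num), Real.one_rpow,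
        one_div_pow] at h4
      rw [← div_le_iff₀' (by positivity)]
      refine le_trans (le_of_eq ?_) h4
      field_simp
    calc _ ≤ ∑ n ∈ I, 3 ^ s * e n := Finset.sum_le_sum fun n _ => hbound n
      _ ≤ 3 ^ s * (2 * δ') := by
        rw [← Finset.mul_sum]
        exact mul_le_mul_of_nonneg_left (hesum I) (by positivity)
      _ ≤ 3 ^ s * (2 * (δ / (2 * 3 ^ s))) := by
        gcongr
        exact min_le_right _ _
      _ = δ := by field_simp

/-- No limit measure is needed: by compactness a cover of the intersection, slightly thickened,
already covers some stage by finitely many pieces, and `sum_sq_le_of_cover` applies at a stage finer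
than all of them. -/
lemma hausdorffMeasure_iInter_weightSupport_ne_zero {D : Finset ℕ} (hD : ∀ d ∈ D, d < 3) {s β : ℝ}
    (hs : 0 < s) {L : ℕ → ℕ} (hL : Tendsto L atTop atTop) {w : ℕ → ℕ → ℝ}
    (hw : ∀ k, IsGoodWeight D (3 ^ s) β (L k) (w k))
    (hanti : Antitone fun k => weightSupport D (L k) (w k)) :
    Measure.hausdorffMeasure s (⋂ k, weightSupport D (L k) (w k)) ≠ 0 := by
  intro h0
  have hβ : 0 ≤ β := (levelEnergy_nonneg D (by positivity) _ _).trans (hw 0).energy_le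
  obtain ⟨U, j, hU, hUd, hUs⟩ := exists_cover_of_hausdorffMeasure_eq_zero hs h0
    -- Here `28 = 7 * 4` makes the Cauchy–Schwarz bound at most `1 / 4`; `β + 1` avoids dividing by
    -- zero.
    (δ := 1 / (28 * (β + 1))) (by positivity)
  set O : ℕ → Set ℝ := fun n => Metric.thickening ((1 / 3) ^ j n) (U n) with hO
  have hOo : ∀ n, IsOpen (O n) := fun n => Metric.isOpen_thickening
  have hUO : ∀ n, U n ⊆ O n := fun n => Metric.self_subset_thickening (by positivity) _
  obtain ⟨k, hk⟩ := exists_subset_nhds_of_isCompact' (directed_of_isDirected_le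
      (fun _ _ h => hanti h)) (fun k => isCompact_weightSupport D (L k) (w k))
    (fun k => (isCompact_weightSupport D (L k) (w k)).isClosed)
    (U := ⋃ n, O n) (fun x hx => (isOpen_iUnion hOo).mem_nhds
      (Set.iUnion_mono hUO (hU hx)))
  obtain ⟨I, hI⟩ := (isCompact_weightSupport D (L k) (w k)).elim_finite_subcover O hOo hk
  obtain ⟨k', hk', hjk⟩ := ((eventually_ge_atTop k).and
    (hL.eventually_ge_atTop (I.sup j))).exists
  have hne : ∀ n, ∃ y, (U n).Nonempty → y ∈ U n := fun n => by
    by_cases h : (U n).Nonempty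
    · exact ⟨h.some, fun _ => h.some_mem⟩
    · exact ⟨0, fun h' => absurd h' h⟩
  choose y hy using hne
  have hmain := sum_sq_le_of_cover hD (by positivity) (hw k') (I := I) (j := j)
    (fun n hn => (Finset.le_sup hn).trans hjk) (y := y) (fun x hx => by
      have := hI (hanti hk' hx)
      simp only [Set.mem_iUnion, exists_prop] at this
      obtain ⟨n, hn, hxn⟩ := this
      obtain ⟨z, hz, hxz⟩ := Metric.mem_thickening_iff.1 hxn
      refine ⟨n, hn, (abs_sub_le x z (y n)).trans ?_⟩
      rw [Real.dist_eq] at hxz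
      linarith [hUd n z hz (y n) (hy n ⟨z, hz⟩)])
  have h1 : (7 * ∑ n ∈ I, (((3 : ℝ) ^ s) ^ j n)⁻¹) * β ≤ (7 * (1 / (28 * (β + 1)))) * β := by
    gcongr
    exact hUs I
  have h2 : (7 * (1 / (28 * (β + 1)))) * β ≤ 1 / 4 := by
    rw [mul_one_div, div_mul_eq_mul_div, div_le_div_iff₀ (by positivity) (by norm_num)]
    linarith
  linarith

/-! ### Lower bound for the dimension -/

lemma tendsto_triadicLevel {ν : ℝ} (hν : 0 < ν) : Tendsto (triadicLevel ν) atTop atTop :=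
  tendsto_nat_floor_atTop.comp
    (((Real.tendsto_logb_atTop (by norm_num)).comp tendsto_natCast_atTop_atTop).const_mul_atTop hν)

lemma tendsto_triadicLevel_two_pow {ν : ℝ} (hν : 0 < ν) :
    Tendsto (fun i => triadicLevel ν (2 ^ (i + 1)) + 1) atTop atTop :=
  (tendsto_add_atTop_nat 1).comp ((tendsto_triadicLevel hν).comp
    ((tendsto_pow_atTop_atTop_of_one_lt one_lt_two).comp (tendsto_add_atTop_nat 1)))

lemma distNearestInt_sub_le {J : ℕ} {t x : ℝ} (hx : x ∈ triadicIcc J (triadicIndex J t)) :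
    distNearestInt (t - x) ≤ (1 / 3) ^ J := by
  refine (round_le _ ⌊t⌋).trans ?_
  rw [sub_right_comm, Int.self_sub_floor]
  exact abs_sub_le_of_mem_triadicIcc (fract_mem_triadicIcc J t) hx

lemma one_third_pow_lt {ν : ℝ} (hν : 0 ≤ ν) {n m : ℕ} (hn : 1 ≤ n) (hnm : n ≤ m) :
    (1 / 3 : ℝ) ^ (triadicLevel ν m + 1) < 1 / (n : ℝ) ^ ν := by
  have hn' : (0 : ℝ) < n := by exact_mod_cast hn
  rw [one_div_pow]
  refine one_div_lt_one_div_of_lt (by positivity) ?_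
  refine lt_of_le_of_lt ?_ (lt_pow_triadicLevel_add_one ν (hn.trans hnm))
  gcongr

/-- The points lying in an admissible triadic interval of every level. -/
def digitSet (D : Finset ℕ) : Set ℝ := {x | ∀ j, ∃ v ∈ triadic D j, x ∈ triadicIcc j v}

lemma mem_digitSet_of_tendsto {D : Finset ℕ} (hD : ∀ d ∈ D, d < 3) {L : ℕ → ℕ}
    (hL : Tendsto L atTop atTop) {x : ℝ} (h : ∀ k, ∃ v ∈ triadic D (L k), x ∈ triadicIcc (L k) v) :
    x ∈ digitSet D := by
  intro j
  obtain ⟨k, hk⟩ := (hL.eventually_ge_atTop j).exists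
  obtain ⟨v, hv, hx⟩ := h k
  exact ⟨_, div_mem_triadic hD hk hv, triadicIcc_subset_div hk v hx⟩

lemma digitSet_zero_two : digitSet {0, 2} = cantorSet := by
  ext x
  simp [digitSet, cantorSet, preCantorSet_eq_biUnion]

lemma iInter_weightSupport_subset {D : Finset ℕ} (hD : ∀ d ∈ D, d < 3) {a : ℕ → ℕ} {α ν : ℝ}
    (hν : 0 < ν) {i : ℕ → ℕ} (hi : StrictMono i) {w : ℕ → ℕ → ℝ}
    (hw : ∀ k v, w k v ≠ 0 → blockDensity D a (Finset.Ico (2 ^ i k) (2 ^ (i k + 1)))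
        (triadicLevel ν (2 ^ (i k + 1)) + 1) α v ≠ 0) :
    ⋂ k, weightSupport D (triadicLevel ν (2 ^ (i k + 1)) + 1) (w k) ⊆
      approxSet a α ν ∩ digitSet D := by
  intro x hx
  have hx' := fun k => mem_weightSupport.1 (Set.mem_iInter.1 hx k)
  constructor
  · refine Set.infinite_of_forall_exists_gt fun N => ?_
    obtain ⟨v, -, hv, hxv⟩ := hx' N
    have hne := (mul_ne_zero_iff.1 (hw N v hv)).2
    rw [Nat.cast_ne_zero, Finset.card_ne_zero] at hne
    obtain ⟨n, hn⟩ := hne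
    rw [Finset.mem_filter, Finset.mem_Ico] at hn
    have hn1 : 1 ≤ n := Nat.one_le_two_pow.trans hn.1.1
    refine ⟨n, ⟨hn1, ?_⟩, ?_⟩
    · rw [← hn.2] at hxv
      exact (distNearestInt_sub_le hxv).trans_lt (one_third_pow_lt hν.le hn1 hn.1.2.le)
    · exact (hi.id_le N).trans_lt (Nat.lt_two_pow_self.trans_le hn.1.1)
  · refine mem_digitSet_of_tendsto hD
      ((tendsto_triadicLevel_two_pow hν).comp hi.tendsto_atTop) fun k => ?_
    obtain ⟨v, hv, -, hxv⟩ := hx' k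
    exact ⟨v, hv, hxv⟩

/-- With `t = 3 ^ s`, the condition on `s` is exactly the summability condition `ν * logb 3 (3 * t /
D.card) < 1`; since `1 / ν ≤ 1` it also gives `t < D.card`. -/
lemma ae_le_dimH_approxSet_inter_digitSet {D : Finset ℕ} (hD : ∀ d ∈ D, d < 3)
    {a : ℕ → ℕ} (ha : ∀ n, 1 ≤ n → 0 < a n)
    (hgrowth : Tendsto (fun n : ℕ => Real.log ((a (n + 1) : ℝ) / (a n : ℝ)) / Real.log (n : ℝ))
      atTop atTop) {ν s : ℝ} (hν : 1 ≤ ν) (hs : 0 < s)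
    (hsν : s < 1 / ν + Real.logb 3 D.card - 1) :
    ∀ᵐ α ∂unitVolume, ENNReal.ofReal s ≤ dimH (approxSet a α ν ∩ digitSet D) := by
  have hν0 : 0 < ν := by linarith
  have hν1 : 1 / ν ≤ 1 := by rw [div_le_one hν0]; exact hν
  have hq0 : D.card ≠ 0 := fun h => by
    rw [h] at hsν
    simp at hsν hν1
    linarith
  have hq : (0 : ℝ) < D.card := by exact_mod_cast Nat.pos_of_ne_zero hq0
  have hD0 : D.Nonempty := Finset.card_ne_zero.1 hq0
  have hq3 : D.card ≤ 3 := by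
    have := Finset.card_le_card (show D ⊆ Finset.range 3 from fun d hd => Finset.mem_range.2 (hD d hd))
    simpa using this
  have ht1 : 1 < (3 : ℝ) ^ s := Real.one_lt_rpow (by norm_num) hs
  have htq : (3 : ℝ) ^ s < D.card := by
    rw [← Real.lt_logb_iff_rpow_lt (by norm_num) hq]
    linarith
  have hlog : Real.logb 3 (3 * 3 ^ s / D.card) = 1 + s - Real.logb 3 D.card := by
    rw [Real.logb_div (by positivity) (by positivity), Real.logb_mul (by positivity) (by positivity),
      Real.logb_rpow (by norm_num) (by norm_num), Real.logb_self_eq_one (by norm_num)]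
  have hνt : ν * Real.logb 3 (3 * 3 ^ s / D.card) < 1 := by
    rw [hlog, mul_comm, ← lt_div_iff₀ hν0]
    linarith
  filter_upwards [ae_tendsto_levelEnergy_blockDensity hD hD0 ha hgrowth ht1 htq hq3 hν0.le hνt]
    with α hα
  have hJ := tendsto_triadicLevel_two_pow hν0
  obtain ⟨β, i, hi, w, hw, hwM, hanti⟩ := exists_seq_isGoodWeight hD ht1.le htq hJ
    (M := fun i => blockDensity D a (Finset.Ico (2 ^ i) (2 ^ (i + 1)))
      (triadicLevel ν (2 ^ (i + 1)) + 1) α)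
    (fun i v => by rw [blockDensity]; positivity) hα
  have hne := hausdorffMeasure_iInter_weightSupport_ne_zero hD hs (hJ.comp hi.tendsto_atTop) hw hanti
  refine le_trans ?_ (dimH_mono (iInter_weightSupport_subset hD hν0 hi hwM))
  have := le_dimH_of_hausdorffMeasure_ne_zero (d := s.toNNReal)
    (s := ⋂ k, weightSupport D (triadicLevel ν (2 ^ (i k + 1)) + 1) (w k))
    (by rwa [Real.coe_toNNReal _ hs.le])
  exact this

/-! ### Upper bounds by covering -/

lemma dimH_limsup_ball_le {c r : ℕ → ℝ} {H : Set ℕ} {s : ℝ} (hs : 0 < s) (hr : ∀ n, 0 ≤ r n)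
    (hsum : Summable (H.indicator fun n => r n ^ s)) :
    dimH {ξ | {n | n ∈ H ∧ |c n - ξ| < r n}.Infinite} ≤ ENNReal.ofReal s := by
  classical
  set B : ℕ → Set ℝ := fun n => if n ∈ H then Metric.ball (c n) (r n) else ∅ with hB
  set f : ℕ → ENNReal := fun n => Metric.ediam (B n) ^ s with hf
  have hfle : ∀ n, f n ≤ ENNReal.ofReal (2 ^ s * H.indicator (fun n => r n ^ s) n) := by
    intro n
    by_cases h : n ∈ H
    · simp only [hf, hB, if_pos h, Set.indicator_of_mem h]
      rw [← Real.mul_rpow (by norm_num) (hr n),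
        ← ENNReal.ofReal_rpow_of_nonneg (by linarith [hr n]) hs.le, Real.ball_eq_Ioo,
        Real.ediam_Ioo]
      refine le_of_eq ?_
      congr 2
      ring
    · simp [hf, hB, h, hs]
  have hfsum : ∑' n, f n ≠ ⊤ := by
    refine ne_top_of_le_ne_top ?_ (ENNReal.tsum_le_tsum hfle)
    exact (hsum.mul_left _).tsum_ofReal_ne_top
  have htail := ENNReal.tendsto_sum_nat_add f hfsum
  -- A tail sum bounds each of its terms, so its power `1 / s` serves as the mesh of the `N`-th
  -- cover.
  have hR : Tendsto (fun N => (∑' k, f (k + N)) ^ (1 / s)) atTop (nhds 0) := by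
    have := (ENNReal.continuous_rpow_const (y := 1 / s)).tendsto 0
    rw [ENNReal.zero_rpow_of_pos (by positivity)] at this
    exact this.comp htail
  have hle := Measure.hausdorffMeasure_le_liminf_tsum (β := ℕ) (ι := fun _ => ℕ) s
    {ξ | {n | n ∈ H ∧ |c n - ξ| < r n}.Infinite} _ hR (fun N k => B (k + N))
    (Eventually.of_forall fun N k => by
      rw [one_div, ENNReal.le_rpow_inv_iff hs]
      exact ENNReal.le_tsum (f := fun k => f (k + N)) k)
    (Eventually.of_forall fun N ξ hξ => by
      obtain ⟨n, ⟨hn, hnξ⟩, hNn⟩ := Set.Infinite.exists_gt hξ N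
      refine Set.mem_iUnion.2 ⟨n - N, ?_⟩
      rw [Nat.sub_add_cancel hNn.le]
      simp only [hB, if_pos hn, Metric.mem_ball, Real.dist_eq]
      rwa [abs_sub_comm])
  rw [htail.liminf_eq] at hle
  have h0 : Measure.hausdorffMeasure (s.toNNReal : ℝ)
      {ξ | {n | n ∈ H ∧ |c n - ξ| < r n}.Infinite} ≠ ⊤ := by
    rw [Real.coe_toNNReal _ hs.le]
    exact (hle.trans_lt ENNReal.zero_lt_top).ne
  exact dimH_le_of_hausdorffMeasure_ne_top h0

/-- The nearest-integer distance is unfolded into integer translates `e`. For fixed `ξ` only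
finitely many `e` occur, so one of them occurs for infinitely many `n`. The set `H` discards the `n`
that cannot serve points of `T`. -/
lemma dimH_approxSet_inter_le {a : ℕ → ℕ} {α ν s : ℝ} (hν : 0 ≤ ν) (hs : 0 < s) {T : Set ℝ}
    {H : Set ℕ}
    (hH : ∀ n, 1 ≤ n → ∀ ξ ∈ T, distNearestInt (a n * α - ξ) < 1 / (n : ℝ) ^ ν → n ∈ H)
    (hsum : Summable (H.indicator fun n : ℕ => (1 / (n : ℝ) ^ ν) ^ s)) :
    dimH (approxSet a α ν ∩ T) ≤ ENNReal.ofReal s := by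
  have hsub : approxSet a α ν ∩ T ⊆ ⋃ e : ℤ, {ξ | {n | n ∈ H ∧
      |(Int.fract (a n * α) + e) - ξ| < 1 / (n : ℝ) ^ ν}.Infinite} := by
    rintro ξ ⟨hξ, hT⟩
    by_contra hcon
    simp only [Set.mem_iUnion, Set.mem_ofPred_eq, not_exists, Set.not_infinite] at hcon
    refine hξ (((Set.finite_Icc ⌊ξ - 2⌋ ⌈ξ + 1⌉).biUnion fun e _ => hcon e).subset ?_)
    rintro n ⟨hn1, hn⟩
    have hn' : (1 : ℝ) ≤ n := by exact_mod_cast hn1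
    have heq : Int.fract (a n * α) + ((⌊a n * α⌋ - round (a n * α - ξ) : ℤ) : ℝ) - ξ =
        a n * α - ξ - round (a n * α - ξ) := by
      rw [Int.fract]; push_cast; ring
    have hlt : |Int.fract (a n * α) + ((⌊a n * α⌋ - round (a n * α - ξ) : ℤ) : ℝ) - ξ| <
        1 / (n : ℝ) ^ ν := by rw [heq]; exact hn
    have h1 : 1 / (n : ℝ) ^ ν ≤ 1 := by
      rw [div_le_one (by positivity)]; exact Real.one_le_rpow hn' hν
    have h2 := abs_lt.1 (hlt.trans_le h1)
    have h3 := Int.fract_nonneg (a n * α)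
    have h4 := Int.fract_lt_one (a n * α)
    refine Set.mem_biUnion (x := ⌊a n * α⌋ - round (a n * α - ξ)) ⟨?_, ?_⟩
      ⟨hH n hn1 ξ hT hn, hlt⟩
    · have : ((⌊ξ - 2⌋ : ℤ) : ℝ) ≤ ((⌊a n * α⌋ - round (a n * α - ξ) : ℤ) : ℝ) := by
        linarith [Int.floor_le (ξ - 2)]
      exact_mod_cast this
    · have : ((⌊a n * α⌋ - round (a n * α - ξ) : ℤ) : ℝ) ≤ ((⌈ξ + 1⌉ : ℤ) : ℝ) := by
        linarith [Int.le_ceil (ξ + 1)]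
      exact_mod_cast this
  refine (dimH_mono hsub).trans ?_
  rw [dimH_iUnion]
  exact iSup_le fun e => dimH_limsup_ball_le hs (fun n => by positivity) hsum

lemma summable_one_div_rpow_rpow {ν s : ℝ} (h : 1 < ν * s) :
    Summable fun n : ℕ => (1 / (n : ℝ) ^ ν) ^ s := by
  refine (Real.summable_one_div_nat_rpow.2 h).congr fun n => ?_
  rw [Real.div_rpow zero_le_one (by positivity), Real.one_rpow, Real.rpow_mul (Nat.cast_nonneg _)]

lemma dimH_approxSet_le (a : ℕ → ℕ) (α : ℝ) {ν : ℝ} (hν : 0 < ν) :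
    dimH (approxSet a α ν) ≤ ENNReal.ofReal (1 / ν) := by
  have h : ∀ s, 1 / ν < s → dimH (approxSet a α ν) ≤ ENNReal.ofReal s := by
    intro s hs
    have hs0 : 0 < s := lt_trans (by positivity) hs
    have := dimH_approxSet_inter_le (a := a) (α := α) hν.le hs0 (T := Set.univ) (H := Set.univ)
      (fun _ _ _ _ _ => Set.mem_univ _) (by
        rw [Set.indicator_univ]
        refine summable_one_div_rpow_rpow ?_
        rwa [div_lt_iff₀' hν] at hs)
    rwa [Set.inter_univ] at this
  have hlim : Tendsto (fun s => ENNReal.ofReal s) (nhdsWithin (1 / ν) (Set.Ioi (1 / ν)))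
      (nhds (ENNReal.ofReal (1 / ν))) :=
    (ENNReal.continuous_ofReal.tendsto _).mono_left nhdsWithin_le_nhds
  exact ge_of_tendsto hlim (eventually_nhdsWithin_of_forall h)

/-! ### Hits near the Cantor set -/

/-- The level `j` indices that are equal or cyclically adjacent to an element of `triadic D j`. -/
def triadicNhd (D : Finset ℕ) (j : ℕ) : Finset ℕ :=
  -- Modulo `3 ^ j` the summand `3 ^ j - 1` is `-1`, so the shifts are `-1`, `0` and `1`.
  (triadic D j ×ˢ Finset.range 3).image fun p => (p.1 + p.2 + (3 ^ j - 1)) % 3 ^ j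

lemma card_triadicNhd_le {D : Finset ℕ} (hD : ∀ d ∈ D, d < 3) (j : ℕ) :
    (triadicNhd D j).card ≤ 3 * D.card ^ j := by
  refine Finset.card_image_le.trans ?_
  rw [Finset.card_product, card_triadic hD, Finset.card_range, mul_comm]

lemma lt_of_mem_triadicNhd {D : Finset ℕ} {j v : ℕ} (hv : v ∈ triadicNhd D j) : v < 3 ^ j := by
  obtain ⟨p, -, rfl⟩ := Finset.mem_image.1 hv
  exact Nat.mod_lt _ (by positivity)

lemma triadicIndex_mem_triadicNhd {D : Finset ℕ} {j v : ℕ} (hv : v ∈ triadic D j) {t ξ : ℝ}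
    (hξ : ξ ∈ triadicIcc j v) (h : distNearestInt (t - ξ) < (1 / 3) ^ j) :
    triadicIndex j t ∈ triadicNhd D j := by
  set w := triadicIndex j t with hw
  set e : ℤ := ⌊t⌋ - round (t - ξ) with he
  have hp : (0 : ℝ) < 3 ^ j := by positivity
  have heq : t - ξ - round (t - ξ) = Int.fract t + e - ξ := by
    rw [he, Int.fract]; push_cast; ring
  rw [distNearestInt, heq, one_div_pow, lt_div_iff₀ hp] at h
  have h' := abs_lt.1 (show |(Int.fract t + e - ξ) * 3 ^ j| < 1 by rwa [abs_mul, abs_of_pos hp])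
  have h1 := triadicIndex_div_le j t
  have h2 := lt_triadicIndex_div j t
  rw [← hw, div_le_iff₀ hp] at h1
  rw [← hw, lt_div_iff₀ hp] at h2
  have h3 := hξ.1
  have h4 := hξ.2
  rw [div_le_iff₀ hp] at h3
  rw [le_div_iff₀ hp] at h4
  have h5 : ((w : ℤ) : ℝ) + ((e * 3 ^ j : ℤ) : ℝ) < (((v : ℤ) + 2 : ℤ) : ℝ) := by
    push_cast; nlinarith [h'.2]
  have h6 : (((v : ℤ) - 2 : ℤ) : ℝ) < ((w : ℤ) : ℝ) + ((e * 3 ^ j : ℤ) : ℝ) := by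
    push_cast; nlinarith [h'.1]
  rw [← Int.cast_add, Int.cast_lt] at h5 h6
  obtain ⟨d, hd, hwd⟩ : ∃ d : ℕ, d < 3 ∧ (w : ℤ) + e * 3 ^ j = v + d - 1 :=
    ⟨((w : ℤ) + e * 3 ^ j - v + 1).toNat, by omega, by omega⟩
  refine Finset.mem_image.2 ⟨(v, d), Finset.mem_product.2 ⟨hv, Finset.mem_range.2 hd⟩, ?_⟩
  have hpos : 1 ≤ 3 ^ j := Nat.one_le_pow _ _ (by norm_num)
  have hlt : w < 3 ^ j := triadicIndex_lt j t
  have hz : (((v + d + (3 ^ j - 1) : ℕ) : ℤ)) = w + (e + 1) * 3 ^ j := by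
    push_cast [Nat.cast_sub hpos]
    linarith
  have : (((v + d + (3 ^ j - 1)) % 3 ^ j : ℕ) : ℤ) = w := by
    rw [Int.natCast_mod, hz]
    push_cast
    rw [Int.add_mul_emod_self_right]
    exact Int.emod_eq_of_lt (by positivity) (by exact_mod_cast hlt)
  exact_mod_cast this

lemma cantorDim_eq_logb : cantorDim = Real.logb 3 2 := rfl

lemma cantorDim_lt_one : cantorDim < 1 := by
  rw [cantorDim_eq_logb, Real.logb_lt_iff_lt_rpow (by norm_num) (by norm_num), Real.rpow_one]
  norm_num

lemma two_thirds_pow (j : ℕ) : (2 : ℝ) ^ j / 3 ^ j = ((3 : ℝ) ^ j) ^ (cantorDim - 1) := by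
  have h2 : (2 : ℝ) = (3 : ℝ) ^ cantorDim := by
    rw [cantorDim_eq_logb, Real.rpow_logb (by norm_num) (by norm_num) (by norm_num)]
  have h3 : ((3 : ℝ) ^ j) ^ cantorDim = 2 ^ j := by
    rw [← Real.rpow_natCast 3 j, ← Real.rpow_mul (by norm_num), mul_comm,
      Real.rpow_mul (by norm_num), ← h2, Real.rpow_natCast]
  rw [Real.rpow_sub_one (by positivity), h3]

/-- The set of `α` for which `a n α` is so close to the Cantor set that `n` may contribute to
`approxSet a α ν ∩ cantorSet`. -/
def nearCantor (a : ℕ → ℕ) (ν : ℝ) (n : ℕ) : Set ℝ :=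
  hitSet (a n) (triadicLevel ν n) (triadicNhd {0, 2} (triadicLevel ν n))

lemma mem_nearCantor {a : ℕ → ℕ} {α ν : ℝ} (hν : 0 ≤ ν) {n : ℕ} (hn : 1 ≤ n) {ξ : ℝ}
    (hξ : ξ ∈ cantorSet) (h : distNearestInt (a n * α - ξ) < 1 / (n : ℝ) ^ ν) :
    α ∈ nearCantor a ν n := by
  rw [← digitSet_zero_two] at hξ
  obtain ⟨v, hv, hx⟩ := hξ (triadicLevel ν n)
  refine triadicIndex_mem_triadicNhd hv hx (h.trans_le ?_)
  rw [one_div_pow]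
  exact one_div_le_one_div_of_le (by positivity) (pow_triadicLevel_le hν hn)

lemma measureReal_nearCantor_le {a : ℕ → ℕ} (ha : ∀ n, 1 ≤ n → 0 < a n) (ν : ℝ)
    {n : ℕ} (hn : 1 ≤ n) :
    unitVolume.real (nearCantor a ν n) ≤ 9 / 2 * ((n : ℝ) ^ ν) ^ (cantorDim - 1) := by
  have hD : ∀ d ∈ ({0, 2} : Finset ℕ), d < 3 := by decide
  have hn' : (0 : ℝ) < n := by exact_mod_cast hn
  rw [nearCantor, measureReal_hitSet (ha n hn) fun v hv => lt_of_mem_triadicNhd hv]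
  set j := triadicLevel ν n with hj
  have hcard : ((triadicNhd {0, 2} j).card : ℝ) ≤ 3 * 2 ^ j := by
    exact_mod_cast card_triadicNhd_le hD j
  calc _ ≤ 3 * 2 ^ j / (3 : ℝ) ^ j := by gcongr
    -- One factor `2 / 3` is borrowed to reach level `j + 1`: the exponent is negative, so a lower
    -- bound for the power of `3` is needed.
    _ = 9 / 2 * ((3 : ℝ) ^ (j + 1)) ^ (cantorDim - 1) := by
      rw [← two_thirds_pow, pow_succ, pow_succ]; field_simp; norm_num
    _ ≤ _ := by
      refine mul_le_mul_of_nonneg_left ?_ (by norm_num)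
      exact Real.rpow_le_rpow_of_nonpos (by positivity)
        (lt_pow_triadicLevel_add_one ν hn).le (by linarith [cantorDim_lt_one])

lemma ae_summable_nearCantor {a : ℕ → ℕ} (ha : ∀ n, 1 ≤ n → 0 < a n) {ν s : ℝ}
    (h : 1 < ν * (1 - cantorDim + s)) :
    ∀ᵐ α ∂unitVolume,
      Summable ({n | α ∈ nearCantor a ν n}.indicator fun n : ℕ => (1 / (n : ℝ) ^ ν) ^ s) := by
  have hm : ∀ n, MeasurableSet (nearCantor a ν n) := fun n => measurableSet_hitSet _ _ _
  have hint : ∀ n, ∫ α, (nearCantor a ν n).indicator (fun _ => (1 / (n : ℝ) ^ ν) ^ s) α ∂unitVolume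
      = unitVolume.real (nearCantor a ν n) * (1 / (n : ℝ) ^ ν) ^ s := fun n => by
    rw [integral_indicator_const _ (hm n), smul_eq_mul]
  have := ae_summable_of_summable_integral (P := unitVolume)
    (f := fun n => (nearCantor a ν n).indicator fun _ => (1 / (n : ℝ) ^ ν) ^ s)
    (fun n α => Set.indicator_nonneg (fun _ _ => by positivity) _)
    (fun n => (integrable_const _).indicator (hm n)) (by
      simp_rw [hint]
      refine Summable.of_norm_bounded_eventually_nat
        (g := fun n : ℕ => 9 / 2 * (1 / (n : ℝ) ^ ν) ^ (1 - cantorDim + s))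
        ((summable_one_div_rpow_rpow h).mul_left _) ?_
      filter_upwards [eventually_ge_atTop 1] with n hn
      have hn' : (0 : ℝ) < n := by exact_mod_cast hn
      rw [Real.norm_of_nonneg (by positivity), Real.rpow_add (by positivity), ← mul_assoc]
      refine mul_le_mul_of_nonneg_right ?_ (by positivity)
      refine (measureReal_nearCantor_le ha ν hn).trans (le_of_eq ?_)
      rw [one_div, Real.inv_rpow (by positivity), ← Real.rpow_neg (by positivity), neg_sub])
  filter_upwards [this] with α hα
  refine hα.congr fun n => ?_
  simp [Set.indicator]

/-! ### Nonemptiness at the critical exponent -/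

/-- A Borel–Cantelli lemma for asymptotically pairwise quasi-independent events. -/
lemma ae_frequently_mem_of_not_summable {Ω : Type*} [MeasurableSpace Ω] (P : Measure Ω)
    [IsProbabilityMeasure P] {A : ℕ → Set Ω} (hA : ∀ n, MeasurableSet (A n))
    (hsum : ¬ Summable fun n => P.real (A n))
    (hpair : ∀ ε > 0, ∃ n₀ : ℕ, ∀ n ≥ n₀, ∀ m > n,
      P.real (A n ∩ A m) ≤ (1 + ε) * (P.real (A n) * P.real (A m))) :
    ∀ᵐ ω ∂P, ∃ᶠ n in atTop, ω ∈ A n := by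
  have hzero : ∀ n₁ : ℕ, P.real {ω | ∀ n ≥ n₁, ω ∉ A n} = 0 := by
    intro n₁
    refine le_antisymm (le_of_forall_pos_le_add fun ε hε => ?_) measureReal_nonneg
    obtain ⟨n₀, hn₀⟩ := hpair (ε / 2) (by positivity)
    set k := max n₀ n₁ with hk
    have hdiv : Tendsto (fun M => ∑ i ∈ Finset.range M, P.real (A (i + k))) atTop atTop :=
      (not_summable_iff_tendsto_nat_atTop_of_nonneg fun n => measureReal_nonneg).1
        (mt (summable_nat_add_iff (f := fun n => P.real (A n)) k).1 hsum)
    -- Chebyshev bounds the probability of no occurrence by `1 / Λ + ε / 2`, which is at most `ε`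
    -- once `Λ ≥ 2 / ε`.
    obtain ⟨M, hM⟩ := (hdiv.eventually_ge_atTop (2 / ε)).exists
    set S : Finset ℕ := (Finset.range M).map (addRightEmbedding k) with hS
    have hSk : ∀ n ∈ S, k ≤ n := by
      intro n hn
      obtain ⟨i, -, rfl⟩ := Finset.mem_map.1 hn
      simp
    set Λ := ∑ n ∈ S, P.real (A n) with hΛ
    have hΛM : 2 / ε ≤ Λ := by
      rw [hΛ, hS, Finset.sum_map]; exact hM
    have hΛ0 : 0 < Λ := lt_of_lt_of_le (by positivity) hΛM
    have hvar := integral_sq_sum_indicator_sub_le P S hA (ε := ε / 2) (by positivity)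
      fun n hn m _ hnm => hn₀ n ((le_max_left _ _).trans (hSk n hn)) m hnm
    rw [← hΛ] at hvar
    have hmeas : ∀ n, Measurable ((A n).indicator (1 : Ω → ℝ)) := fun n =>
      measurable_one.indicator (hA n)
    have hint : Integrable (fun ω => (∑ n ∈ S, (A n).indicator (1 : Ω → ℝ) ω - Λ) ^ 2) P := by
      refine Integrable.of_bound (C := (S.card + |Λ|) ^ 2)
        (Measurable.aestronglyMeasurable (by fun_prop)) (ae_of_all _ fun ω => ?_)
      rw [Real.norm_eq_abs, abs_pow]
      gcongr
      refine (abs_sub _ _).trans ?_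
      gcongr
      refine (Finset.abs_sum_le_sum_abs _ _).trans ?_
      rw [Finset.card_eq_sum_ones]
      push_cast
      refine Finset.sum_le_sum fun n _ => ?_
      by_cases h : ω ∈ A n <;> simp [h]
    have hmarkov := mul_meas_ge_le_integral_of_nonneg
      (ae_of_all P fun ω => sq_nonneg (∑ n ∈ S, (A n).indicator (1 : Ω → ℝ) ω - Λ)) hint (Λ ^ 2)
    have hsub : {ω | ∀ n ≥ n₁, ω ∉ A n} ⊆
        {ω | Λ ^ 2 ≤ (∑ n ∈ S, (A n).indicator (1 : Ω → ℝ) ω - Λ) ^ 2} := by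
      intro ω hω
      have : ∑ n ∈ S, (A n).indicator (1 : Ω → ℝ) ω = 0 := Finset.sum_eq_zero fun n hn =>
        Set.indicator_of_notMem (hω n ((le_max_right _ _).trans (hSk n hn))) _
      change Λ ^ 2 ≤ (∑ n ∈ S, (A n).indicator (1 : Ω → ℝ) ω - Λ) ^ 2
      rw [this, zero_sub, neg_sq]
    have h1 := measureReal_mono hsub (measure_ne_top P _)
    have h2 : Λ ^ 2 * P.real {ω | ∀ n ≥ n₁, ω ∉ A n} ≤ Λ ^ 2 * ε := by
      have h3 : Λ ≤ ε / 2 * Λ ^ 2 := by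
        rw [div_le_iff₀ hε] at hΛM
        nlinarith
      calc _ ≤ _ := mul_le_mul_of_nonneg_left h1 (sq_nonneg _)
        _ ≤ _ := hmarkov
        _ ≤ _ := hvar
        _ ≤ _ := by linarith
    rw [zero_add]
    exact le_of_mul_le_mul_left h2 (by positivity)
  have hae : ∀ᵐ ω ∂P, ∀ n₁ : ℕ, ¬ ∀ n ≥ n₁, ω ∉ A n := by
    rw [ae_all_iff]
    intro n₁
    have := hzero n₁
    rw [measureReal_eq_zero_iff] at this
    rw [ae_iff]
    simpa only [not_not] using this
  filter_upwards [hae] with ω hω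
  rw [frequently_atTop]
  intro n₁
  have := hω n₁
  push Not at this
  exact this

/-- The exponent beyond which `approxSet a α ν` misses the Cantor set. -/
noncomputable def criticalExponent : ℝ := 1 / (1 - cantorDim)

lemma criticalExponent_pos : 0 < criticalExponent :=
  one_div_pos.2 (by linarith [cantorDim_lt_one])

/-- The probability is `2 ^ (-j) * (2 / 3) ^ J`, and the critical exponent is the one for which this
is of order `1 / n`, so the sum diverges. -/
lemma ae_frequently_hit_triadic {a : ℕ → ℕ} (ha : ∀ n, 1 ≤ n → 0 < a n)
    (hgrowth : Tendsto (fun n : ℕ => Real.log ((a (n + 1) : ℝ) / (a n : ℝ)) / Real.log (n : ℝ))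
      atTop atTop) {j u : ℕ} (hu : u ∈ triadic {0, 2} j) :
    ∀ᵐ α ∂unitVolume, ∃ᶠ n in atTop, α ∈ hitSet (a n) (triadicLevel criticalExponent n + 1)
      ((triadic {0, 2} (triadicLevel criticalExponent n + 1)).filter fun v =>
        v / 3 ^ (triadicLevel criticalExponent n + 1 - j) = u) := by
  have hD : ∀ d ∈ ({0, 2} : Finset ℕ), d < 3 := by decide
  set ν := criticalExponent with hν
  have hν0 : 0 < ν := criticalExponent_pos
  set J : ℕ → ℕ := fun n => triadicLevel ν n + 1 with hJ
  set B : ℕ → Finset ℕ := fun n =>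
    (triadic {0, 2} (J n)).filter fun v => v / 3 ^ (J n - j) = u with hB
  have hBlt : ∀ n, ∀ v ∈ B n, v < 3 ^ J n := fun n v hv =>
    lt_pow_of_mem_triadic hD (Finset.mem_filter.1 hv).1
  have hJle : ∀ n, 1 ≤ n → (3 : ℝ) ^ J n ≤ 3 * (n : ℝ) ^ ν := fun n hn => by
    rw [hJ, pow_succ, mul_comm]
    exact mul_le_mul_of_nonneg_left (pow_triadicLevel_le hν0.le hn) (by norm_num)
  have hP : ∀ n, 1 ≤ n → unitVolume.real (hitSet (a n) (J n) (B n)) = (B n).card / 3 ^ J n :=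
    fun n hn => measureReal_hitSet (ha n hn) (hBlt n)
  refine ae_frequently_mem_of_not_summable unitVolume (A := fun n => hitSet (a n) (J n) (B n))
    (fun n => measurableSet_hitSet _ _ _) (fun hsum => ?_) fun ε hε => ?_
  · refine Real.not_summable_one_div_natCast ?_
    refine Summable.of_norm_bounded_eventually_nat
      (hsum.mul_left (2 ^ j * (3 : ℝ) ^ (1 - cantorDim))) ?_
    filter_upwards [eventually_ge_atTop 1, (tendsto_triadicLevel hν0).eventually_ge_atTop j]
      with n hn hjn
    have hn' : (0 : ℝ) < n := by exact_mod_cast hn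
    have hjJ : j ≤ J n := hjn.trans (Nat.le_succ _)
    have hcard : ((B n).card : ℝ) = 2 ^ J n / 2 ^ j := by
      rw [hB, card_triadic_fiber hD hjJ hu, eq_div_iff (by positivity)]
      push_cast
      rw [show ((({0, 2} : Finset ℕ).card : ℕ) : ℝ) = 2 by norm_num, ← pow_add,
        Nat.sub_add_cancel hjJ]
    rw [Real.norm_of_nonneg (by positivity), hP n hn, hcard]
    have h1 : (3 * (n : ℝ) ^ ν) ^ (cantorDim - 1) ≤ 2 ^ J n / 3 ^ J n := by
      rw [two_thirds_pow]
      exact Real.rpow_le_rpow_of_nonpos (by positivity) (hJle n hn) (by linarith [cantorDim_lt_one])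
    have h2 : (3 * (n : ℝ) ^ ν) ^ (cantorDim - 1) = 3 ^ (cantorDim - 1) * (1 / n) := by
      have : ν * (cantorDim - 1) = -1 := by
        have : 1 - cantorDim ≠ 0 := by linarith [cantorDim_lt_one]
        rw [hν, criticalExponent]
        field_simp
        ring
      rw [Real.mul_rpow (by norm_num) (by positivity), ← Real.rpow_mul hn'.le, this,
        Real.rpow_neg_one, one_div]
    have h3 : (3 : ℝ) ^ (1 - cantorDim) * 3 ^ (cantorDim - 1) = 1 := by
      rw [← Real.rpow_add (by norm_num)]; simp
    calc (1 : ℝ) / n = (3 : ℝ) ^ (1 - cantorDim) * (3 ^ (cantorDim - 1) * (1 / n)) := by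
          rw [← mul_assoc, h3, one_mul]
      _ ≤ (3 : ℝ) ^ (1 - cantorDim) * (2 ^ J n / 3 ^ J n) := by
          rw [← h2]; gcongr
      _ = _ := by field_simp
  · obtain ⟨n₀, hn₀1, hn₀⟩ := eventually_rpow_mul_le_of_growth ha hgrowth (C := ν + 1) (by linarith)
    obtain ⟨n₂, hn₂⟩ := exists_nat_ge (3 / ε)
    refine ⟨max n₀ n₂, fun n hn m hm => ?_⟩
    have hn1 : 1 ≤ n := hn₀1.trans ((le_max_left _ _).trans hn)
    have hm1 : 1 ≤ m := hn1.trans hm.le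
    have hn' : (0 : ℝ) < n := by exact_mod_cast hn1
    have han : (0 : ℝ) < a n := by exact_mod_cast ha n hn1
    have ham : (0 : ℝ) < a m := by exact_mod_cast ha m hm1
    rw [hP n hn1, hP m hm1]
    refine (measureReal_hitSet_inter_le (ha n hn1) (ha m hm1) (hBlt n) (hBlt m)).trans ?_
    gcongr
    rw [div_le_iff₀ ham]
    have hg := hn₀ n ((le_max_left _ _).trans hn) m hm
    rw [Real.rpow_add_one hn'.ne'] at hg
    have h3 : 3 ≤ ε * n := by
      have : (3 : ℝ) / ε ≤ n := hn₂.trans (by exact_mod_cast (le_max_right _ _).trans hn)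
      rwa [div_le_iff₀' hε] at this
    calc (3 : ℝ) ^ J n * a n ≤ 3 * (n : ℝ) ^ ν * a n := by gcongr; exact hJle n hn1
      _ ≤ (ε * n) * (n : ℝ) ^ ν * a n := by gcongr
      _ = ε * ((n : ℝ) ^ ν * n * a n) := by ring
      _ ≤ _ := by gcongr

/-- Almost surely every Cantor interval is hit infinitely often at the critical scale. Choosing each
new hit inside the interval of the previous one gives nested compact intervals; their common point
is approximated by all the chosen `a n α`. -/
lemma ae_nonempty_approxSet_criticalExponent {a : ℕ → ℕ} (ha : ∀ n, 1 ≤ n → 0 < a n)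
    (hgrowth : Tendsto (fun n : ℕ => Real.log ((a (n + 1) : ℝ) / (a n : ℝ)) / Real.log (n : ℝ))
      atTop atTop) :
    ∀ᵐ α ∂unitVolume, (approxSet a α criticalExponent ∩ cantorSet).Nonempty := by
  have hD : ∀ d ∈ ({0, 2} : Finset ℕ), d < 3 := by decide
  set ν := criticalExponent with hν
  have hν0 : 0 < ν := criticalExponent_pos
  set J : ℕ → ℕ := fun n => triadicLevel ν n + 1 with hJ
  have hJt : Tendsto J atTop atTop := (tendsto_add_atTop_nat 1).comp (tendsto_triadicLevel hν0)
  have hae : ∀ᵐ α ∂unitVolume, ∀ j u : ℕ, u ∈ triadic {0, 2} j →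
      ∃ᶠ n in atTop, α ∈ hitSet (a n) (J n)
        ((triadic {0, 2} (J n)).filter fun v => v / 3 ^ (J n - j) = u) := by
    simp only [ae_all_iff]
    exact fun j u hu => ae_frequently_hit_triadic ha hgrowth hu
  filter_upwards [hae] with α hα
  let idx : ℕ → ℕ := fun n => triadicIndex (J n) (a n * α)
  have hnext : ∀ n₀ j u : ℕ, u ∈ triadic {0, 2} j → ∃ n > n₀, j ≤ J n ∧
      idx n ∈ triadic {0, 2} (J n) ∧ idx n / 3 ^ (J n - j) = u := by
    intro n₀ j u hu
    obtain ⟨n, h1, h2, h3⟩ := ((hα j u hu).and_eventually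
      ((eventually_gt_atTop n₀).and (hJt.eventually_ge_atTop j))).exists
    have h4 := Finset.mem_filter.1 h1
    exact ⟨n, h2, h3, h4.1, h4.2⟩
  have hstep : ∀ p : {n // idx n ∈ triadic {0, 2} (J n)},
      ∃ q : {n // idx n ∈ triadic {0, 2} (J n)}, p.1 < q.1 ∧ J p.1 ≤ J q.1 ∧
        idx q.1 / 3 ^ (J q.1 - J p.1) = idx p.1 := by
    rintro ⟨n, hn⟩
    obtain ⟨m, h1, h2, h3, h4⟩ := hnext n (J n) (idx n) hn
    exact ⟨⟨m, h3⟩, h1, h2, h4⟩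
  choose step hs1 hs2 hs3 using hstep
  obtain ⟨m₀, -, -, hm₀, -⟩ := hnext 0 0 0 (by simp [triadic])
  obtain ⟨s, hs⟩ : ∃ s : ℕ → {n // idx n ∈ triadic {0, 2} (J n)}, ∀ k, s (k + 1) = step (s k) :=
    ⟨fun k => Nat.rec ⟨m₀, hm₀⟩ (fun _ p => step p) k, fun _ => rfl⟩
  have hmono : StrictMono fun k => (s k).1 := strictMono_nat_of_lt_succ fun k => by
    rw [hs]; exact hs1 (s k)
  obtain ⟨x, hx⟩ := IsCompact.nonempty_iInter_of_sequence_nonempty_isCompact_isClosed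
    (fun k => triadicIcc (J (s k).1) (idx (s k).1))
    (fun k => by
      have := triadicIcc_subset_div (hs2 (s k)) (idx (step (s k)).1)
      rwa [hs3, ← hs] at this)
    (fun k => triadicIcc_nonempty _ _) (isCompact_triadicIcc _ _)
    (fun k => (isCompact_triadicIcc _ _).isClosed)
  rw [Set.mem_iInter] at hx
  refine ⟨x, Set.infinite_of_forall_exists_gt fun N => ?_, ?_⟩
  · have hN : N < (s (N + 1)).1 := hmono.le_apply (x := N + 1)
    have h1 : 1 ≤ (s (N + 1)).1 := by omega
    exact ⟨(s (N + 1)).1, ⟨h1, (distNearestInt_sub_le (hx _)).trans_lt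
      (one_third_pow_lt hν0.le h1 le_rfl)⟩, hN⟩
  · rw [← digitSet_zero_two]
    exact mem_digitSet_of_tendsto hD (hJt.comp hmono.tendsto_atTop)
      fun k => ⟨_, (s k).2, hx k⟩

/-! ### From rational parameters in the unit interval to the theorem -/

lemma approxSet_anti (a : ℕ → ℕ) (α : ℝ) {ν ν' : ℝ} (h : ν ≤ ν') :
    approxSet a α ν' ⊆ approxSet a α ν := by
  refine fun ξ hξ => Set.Infinite.mono (fun n hn => ⟨hn.1, hn.2.trans_le ?_⟩) hξ
  have h1 : (1 : ℝ) ≤ n := by exact_mod_cast hn.1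
  exact one_div_le_one_div_of_le (by positivity) (Real.rpow_le_rpow_of_exponent_le h1 h)

lemma approxSet_add_one (a : ℕ → ℕ) (α ν : ℝ) : approxSet a (α + 1) ν = approxSet a α ν := by
  have h : ∀ (n : ℕ) (ξ : ℝ), distNearestInt (a n * (α + 1) - ξ) = distNearestInt (a n * α - ξ) := by
    intro n ξ
    rw [distNearestInt, distNearestInt, show (a n : ℝ) * (α + 1) - ξ = a n * α - ξ + a n by ring,
      round_add_natCast]
    push_cast
    congr 1
    ring
  simp only [approxSet, h]

lemma ae_of_ae_unitVolume {p : ℝ → Prop} (hp : Function.Periodic p 1)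
    (h : ∀ᵐ α ∂unitVolume, p α) : ∀ᵐ α : ℝ ∂volume, p α := by
  rw [ae_restrict_iff' measurableSet_Ioc] at h
  have h2 : ∀ᵐ α : ℝ ∂volume, ∀ m : ℤ, α - m ∈ Set.Ioc (0 : ℝ) 1 → p (α - m) := by
    rw [ae_all_iff]
    exact fun m => (measurePreserving_sub_right volume (m : ℝ)).quasiMeasurePreserving.ae h
  filter_upwards [h2] with α hα
  have h3 := hα (⌈α⌉ - 1) (by
    push_cast
    constructor <;> linarith [Int.ceil_lt_add_one α, Int.le_ceil α])
  have h4 := hp.sub_zsmul_eq (x := α) (⌈α⌉ - 1)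
  rw [zsmul_one] at h4
  rwa [h4] at h3

lemma ofReal_le_of_forall_lt {d : ℝ} {X : ENNReal}
    (h : ∀ s, 0 < s → s < d → ENNReal.ofReal s ≤ X) : ENNReal.ofReal d ≤ X := by
  rcases le_or_gt d 0 with hd | hd
  · simp [ENNReal.ofReal_of_nonpos hd]
  · have hlim : Tendsto (fun s => ENNReal.ofReal s) (nhdsWithin d (Set.Iio d))
        (nhds (ENNReal.ofReal d)) :=
      (ENNReal.continuous_ofReal.tendsto _).mono_left nhdsWithin_le_nhds
    refine le_of_tendsto hlim ?_
    filter_upwards [self_mem_nhdsWithin, mem_nhdsWithin_of_mem_nhds (lt_mem_nhds hd)] with s h1 h2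
    exact h s h2 h1

lemma le_ofReal_of_forall_gt {d : ℝ} {X : ENNReal} (h : ∀ s, d < s → X ≤ ENNReal.ofReal s) :
    X ≤ ENNReal.ofReal d :=
  ge_of_tendsto ((ENNReal.continuous_ofReal.tendsto d).mono_left nhdsWithin_le_nhds)
    (eventually_nhdsWithin_of_forall (s := Set.Ioi d) h)

/-- Lower bounds for rational parameters give the lower bound for every exponent. -/
lemma ofReal_le_dimH_of_rat {a : ℕ → ℕ} {α c : ℝ} (hc : c ≤ 0) {T : Set ℝ}
    (h : ∀ q s : ℚ, (1 : ℝ) ≤ q → (0 : ℝ) < s → (s : ℝ) < 1 / q + c →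
      ENNReal.ofReal s ≤ dimH (approxSet a α q ∩ T)) {ν : ℝ} (hν : 1 ≤ ν) :
    ENNReal.ofReal (1 / ν + c) ≤ dimH (approxSet a α ν ∩ T) := by
  have hν0 : 0 < ν := by linarith
  refine ofReal_le_of_forall_lt fun s hs0 hs => ?_
  obtain ⟨s', h1, h2⟩ := exists_rat_btwn hs
  have hs' : 0 < (s' : ℝ) - c := by linarith
  have h3 : ν < 1 / (s' - c) := by
    rw [lt_one_div hν0 hs']; linarith
  obtain ⟨q, h4, h5⟩ := exists_rat_btwn h3
  have hq : (0 : ℝ) < q := by linarith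
  rw [lt_one_div hq hs'] at h5
  exact (ENNReal.ofReal_le_ofReal h1.le).trans ((h q s' (by linarith) (by linarith)
    (by linarith)).trans (dimH_mono (Set.inter_subset_inter_left _ (approxSet_anti a α h4.le))))

lemma dimH_approxSet_inter_cantorSet_le {a : ℕ → ℕ} {α : ℝ}
    (h : ∀ q s : ℚ, 1 < (q : ℝ) * (1 - cantorDim + s) →
      Summable ({n | α ∈ nearCantor a q n}.indicator fun n : ℕ => (1 / (n : ℝ) ^ (q : ℝ)) ^ (s : ℝ)))
    {ν : ℝ} (hν : 1 ≤ ν) (hd : 0 ≤ 1 / ν + cantorDim - 1) :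
    dimH (approxSet a α ν ∩ cantorSet) ≤ ENNReal.ofReal (1 / ν + cantorDim - 1) := by
  have hν0 : 0 < ν := by linarith
  refine le_ofReal_of_forall_gt fun s hs => ?_
  obtain ⟨s', h1, h2⟩ := exists_rat_btwn hs
  have h3 : 1 / ν < 1 - cantorDim + s' := by linarith
  have hpos : 0 < 1 - cantorDim + s' := lt_trans (by positivity) h3
  obtain ⟨q, h4, h5⟩ := exists_rat_btwn ((one_div_lt hν0 hpos).1 h3)
  have hq : (0 : ℝ) < q := lt_trans (by positivity) h4
  refine (dimH_mono (Set.inter_subset_inter_left _ (approxSet_anti a α h5.le))).trans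
    ((dimH_approxSet_inter_le hq.le (by linarith : (0 : ℝ) < s')
      (fun n hn ξ hξ hlt => mem_nearCantor hq.le hn hξ hlt) (h q s' ?_)).trans
      (ENNReal.ofReal_le_ofReal h2.le))
  rwa [div_lt_iff₀ hpos] at h4

lemma approxSet_inter_cantorSet_eq_empty {a : ℕ → ℕ} {α : ℝ}
    (h : ∀ q s : ℚ, 1 < (q : ℝ) * (1 - cantorDim + s) →
      Summable ({n | α ∈ nearCantor a q n}.indicator fun n : ℕ => (1 / (n : ℝ) ^ (q : ℝ)) ^ (s : ℝ)))
    {ν : ℝ} (hν : 1 ≤ ν) (hd : 1 / ν + cantorDim - 1 < 0) :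
    approxSet a α ν ∩ cantorSet = ∅ := by
  have hν0 : 0 < ν := by linarith
  have hpos : 0 < 1 - cantorDim := by linarith [cantorDim_lt_one]
  obtain ⟨q, h4, h5⟩ := exists_rat_btwn
    ((one_div_lt hν0 hpos).1 (by linarith : 1 / ν < 1 - cantorDim))
  have hq : (0 : ℝ) < q := lt_trans (by positivity) h4
  -- With exponent `0` every hit contributes `1`, so summability means finitely many hits.
  have hsum := h q 0 (by
    rw [div_lt_iff₀ hpos] at h4
    simpa using h4)
  have hfin : {n | α ∈ nearCantor a q n}.Finite := by
    have h6 := hsum.tendsto_cofinite_zero.eventually_lt_const one_pos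
    refine (Filter.eventually_cofinite.1 h6).subset fun n hn => ?_
    simp only [Set.mem_ofPred_eq] at hn ⊢
    simp [Set.indicator, hn]
  rw [Set.eq_empty_iff_forall_notMem]
  rintro ξ ⟨hξ, hK⟩
  exact approxSet_anti a α h5.le hξ
    (hfin.subset fun n hn => mem_nearCantor hq.le hn.1 hK hn.2)

theorem mainTheorem9 (a : ℕ → ℕ) (ha : ∀ n : ℕ, 1 ≤ n → 0 < a n)
    (hgrowth : Tendsto (fun n : ℕ => Real.log ((a (n + 1) : ℝ) / (a n : ℝ)) / Real.log (n : ℝ))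
      atTop atTop) :
    ∀ᵐ α : ℝ ∂volume, ∀ ν : ℝ, 1 ≤ ν →
      dimH (approxSet a α ν) = ENNReal.ofReal (1 / ν) ∧
      (0 ≤ 1 / ν + cantorDim - 1 →
        (approxSet a α ν ∩ cantorSet).Nonempty ∧
        dimH (approxSet a α ν ∩ cantorSet) = ENNReal.ofReal (1 / ν + cantorDim - 1)) ∧
      (1 / ν + cantorDim - 1 < 0 → approxSet a α ν ∩ cantorSet = ∅) := by
  refine ae_of_ae_unitVolume (fun α => by simp only [approxSet_add_one]) ?_
  -- With all three digits allowed, `logb 3 3 - 1 = 0`, so the digit-set bound becomes the bound `1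
  -- / ν` on the line.
  have hline : ∀ᵐ α ∂unitVolume, ∀ q s : ℚ, (1 : ℝ) ≤ q → (0 : ℝ) < s → (s : ℝ) < 1 / q + 0 →
      ENNReal.ofReal s ≤ dimH (approxSet a α q ∩ digitSet {0, 1, 2}) := by
    simp only [ae_all_iff]
    intro q s hq hs hsq
    refine ae_le_dimH_approxSet_inter_digitSet (by decide) ha hgrowth hq hs ?_
    have : Real.logb 3 (({0, 1, 2} : Finset ℕ).card : ℝ) = 1 := by
      rw [show ((({0, 1, 2} : Finset ℕ).card : ℕ) : ℝ) = 3 by norm_num]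
      exact Real.logb_self_eq_one (by norm_num)
    rw [this]
    linarith
  have hcantor : ∀ᵐ α ∂unitVolume, ∀ q s : ℚ, (1 : ℝ) ≤ q → (0 : ℝ) < s →
      (s : ℝ) < 1 / q + (cantorDim - 1) →
      ENNReal.ofReal s ≤ dimH (approxSet a α q ∩ cantorSet) := by
    simp only [ae_all_iff]
    intro q s hq hs hsq
    rw [← digitSet_zero_two]
    refine ae_le_dimH_approxSet_inter_digitSet (by decide) ha hgrowth hq hs ?_
    rw [show ((({0, 2} : Finset ℕ).card : ℕ) : ℝ) = 2 by norm_num, ← cantorDim_eq_logb]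
    linarith
  have hupper : ∀ᵐ α ∂unitVolume, ∀ q s : ℚ, 1 < (q : ℝ) * (1 - cantorDim + s) →
      Summable ({n | α ∈ nearCantor a q n}.indicator
        fun n : ℕ => (1 / (n : ℝ) ^ (q : ℝ)) ^ (s : ℝ)) := by
    simp only [ae_all_iff]
    exact fun q s h => ae_summable_nearCantor ha h
  filter_upwards [hline, hcantor, hupper, ae_nonempty_approxSet_criticalExponent ha hgrowth]
    with α h1 h2 h3 h4 ν hν
  have hν0 : 0 < ν := by linarith
  refine ⟨le_antisymm (dimH_approxSet_le a α hν0) ?_, fun hd => ⟨?_, le_antisymm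
    (dimH_approxSet_inter_cantorSet_le h3 hν hd) ?_⟩, approxSet_inter_cantorSet_eq_empty h3 hν⟩
  · have := ofReal_le_dimH_of_rat le_rfl h1 hν
    rw [add_zero] at this
    exact this.trans (dimH_mono Set.inter_subset_left)
  · refine h4.mono (Set.inter_subset_inter_left _ (approxSet_anti a α ?_))
    have hpos : 0 < 1 - cantorDim := by linarith [cantorDim_lt_one]
    rw [criticalExponent, le_one_div hν0 hpos]
    linarith
  · rw [add_sub_assoc]
    exact ofReal_le_dimH_of_rat (by linarith [cantorDim_lt_one]) h2 hν
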